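/- **Theorem (the elimination stack is linearizable).** *Object.* Fix a set $T$ of thread ids, a set $\mathit{Val}$ of values and a value $\mathtt{empty}\in \mathit{Val}$. The shared state consists of a pointer `top`, a heap of nodes (`val`, `next`), an array `location` indexed by $T$ holding NULL or a descriptor $(\mathit{op},\mathit{id},\mathit{input})$, and an array `collision` indexed by $\mathbb Z$ holding NULL or a thread id; initially everything is NULL and nothing is allocated. A descriptor $p$ is the triple of the method (push or pop), the id `mytid` of the invoking thread, and the input (of a push). Memory is garbage collected: `malloc` returns an arbitrary address that was never allocated before. Below, $x/y$ means $x$ in a push and $y$ in a pop, and a CAS is a single atomic step. Both methods repeat the following loop body forever, until a return: 1. One iteration of Treiber's stack. Push: `n = malloc(); n->val = p.input; oldTop = top; n->next = oldTop; if CAS(top, oldTop, n) return NULL`. Pop: `oldTop = top; if (oldTop == NULL) return empty; newTop = oldTop->next; if CAS(top, oldTop, newTop) return oldTop->val`. 2. If that CAS failed: `location[mytid] = p; pos = nondet(); do { him = collision[pos] } while (!CAS(collision[pos], him, mytid))`. 3. If `him != NULL`: `q = location[him]`; if moreover `q != NULL & q.id == him & p.op != q.op`, then: if `CAS(location[mytid],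 p, NULL)` succeeds, do the *second CAS* `CAS(location[him], q, p/NULL)`, and return `NULL/q.input` if it succeeds and restart the loop if it fails; if `CAS(location[mytid], p, NULL)` fails, do `val = NULL/location[mytid].input; location[mytid] = NULL; return val`. 4. If one of the tests of step 3 failed: if `CAS(location[mytid], p, NULL)` fails, do `val = NULL/location[mytid].input; location[mytid] = NULL; return val`; otherwise restart the loop. *Executions.* Each thread performs at most one invocation, prescribed by an arbitrary environment. An execution is a finite interleaving of invocations, returns and atomic steps (local tests and actions, accesses to a single shared location, and CASs) of the threads from the initial configuration; it is completed if every invoked thread has returned. Its trace is the sequence of its steps, labelled with thread ids. *Linearizability.* A trace $\tau$ of a completed execution is linearizable with respect to a set $S$ of sequences of operations $m(x)/r$ if there are a map $lp$ from threads to positions of $\tau$ and an enumeration $t_1,\dots,t_n$ without repetition of the threads invoked in $\tau$, such that $lp(t_1)\le\dots\le lp(t_n)$, each $lp(t_i)$ lies strictly between the invocation and the return of $t_i$ in $\tau$, and the sequence of the operations of $t_1,\dots,t_n$ belongs to $S$. Let $S$ be the specification of a sequential, initially empty LIFO stack, in which push returns NULL and a pop on the empty stack returns $\mathtt{empty}$.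 *Claim.* The elimination stack is linearizable with respect to $S$: every trace of a completed execution is linearizable. Moreover, for every completed execution, $lp$ and $t_1,\dots,t_n$ can be chosen such that * for each invoked thread $t$, the step at position $lp(t)$ is either a successful CAS of $t$ on `top`, or a read of `top` = NULL by $t$, where $t$ is a pop that returns $\mathtt{empty}$, or the successful second CAS of a collision in which $t$ takes part, i.e. it is performed by $t$ or it modifies `location[`$t$`]`; * conversely, if the step at position $k$ is a successful CAS of $t$ on `top`, then $lp(t)=k$; and if it is a successful second CAS, performed by $a$ with `him` $=b$, then $lp(a)=lp(b)=k$, one of $a,b$ is a push and the other is a pop, and in the linearization the push is immediately followed by that pop. -/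

import Mathlib

universe u v w

namespace KatObj

/-! ### Syntax: Boolean tests, KAT expressions with atomic read-writes and returns -/

/-- Boolean test expressions over primitive tests `B`. -/
inductive BExp (B : Type) : Type
  | prim (b : B)
  | and (b c : BExp B)
  | or (b c : BExp B)
  | not (b : BExp B)
  | zero
  | one

/-- Truth of a test expression, given the truth of the primitive tests. -/
def BExp.Holds {B : Type} (sem : B → Prop) : BExp B → Prop
  | .prim b => sem b
  | .and b c => b.Holds sem ∧ c.Holds sem
  | .or b c => b.Holds sem ∨ c.Holds sem
  | .not b => ¬ b.Holds sem
  | .zero => False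
  | .one => True

/-- KAT expressions over primitive actions `A`, primitive tests `B` and return expressions `E`.
`arw b a` is the atomic read-write: test `b` and do `a` with no interleaving in between. -/
inductive Kat (A B E : Type) : Type
  | act (a : A)
  | test (b : BExp B)
  | arw (b : BExp B) (a : A)
  | ret (e : E)
  | seq (k k' : Kat A B E)
  | plus (k k' : Kat A B E)
  | star (k : Kat A B E)
  | zero
  | one

infixr:67 " ⬝ " => Kat.seq
infixr:65 " ⊹ " => Kat.plus

/-- A concurrent object for threads `T`: method names with argument types, a KAT implementation of
each method, and the meaning of the primitive symbols on local states `Lo` and shared states `Gl`.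
Actions are relations, since allocation and `nondet()` are nondeterministic. The initial local
state of an invocation may depend on the thread id, which is treated as an additional input. -/
structure ConcObject (T : Type u) : Type (max u (v + 1) (w + 1)) where
  Meth : Type
  Arg : Meth → Type v
  Ret : Type v
  Act : Type
  Test : Type
  RetExp : Type
  Lo : Type w
  Gl : Type w
  actSem : Act → Lo → Gl → Lo → Gl → Prop
  testSem : Test → Lo → Gl → Prop
  retSem : RetExp → Lo → Ret
  initGl : Gl
  initLo : T → (m : Meth) → Arg m → Lo
  code : Meth → Kat Act Test RetExp

/-! ### Operational semantics -/

section Semantics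

variable {T : Type u} (O : ConcObject.{u, v, w} T)

/-- Code of the object. -/
abbrev ConcObject.Code : Type := Kat O.Act O.Test O.RetExp

/-- Labels: invocations, returns, actions, tests and atomic read-writes. -/
inductive Label : Type v
  | inv (m : O.Meth) (x : O.Arg m)
  | ret (r : O.Ret)
  | act (a : O.Act)
  | test (b : BExp O.Test)
  | arw (b : BExp O.Test) (a : O.Act)

/-- A step of one thread, with an optional label. The resulting code is `none` (written `⊥` on
paper) once the thread has returned. -/
inductive Step : O.Lo → O.Gl → O.Code → Option (Label O) → O.Lo → O.Gl → Option O.Code → Prop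
  | act {l g a l' g'} (h : O.actSem a l g l' g') :
      Step l g (.act a) (some (.act a)) l' g' (some .one)
  | test {l g b} (h : b.Holds fun c => O.testSem c l g) :
      Step l g (.test b) (some (.test b)) l g (some .one)
  | arw {l g b a l' g'} (hb : b.Holds fun c => O.testSem c l g) (ha : O.actSem a l g l' g') :
      Step l g (.arw b a) (some (.arw b a)) l' g' (some .one)
  | ret {l g e} : Step l g (.ret e) (some (.ret (O.retSem e l))) l g none
  | plusLeft {l g k k'} : Step l g (.plus k k') none l g (some k)
  | plusRight {l g k k'} : Step l g (.plus k k') none l g (some k')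
  | starUnfold {l g k} : Step l g (.star k) none l g (some (.seq k (.star k)))
  | starExit {l g k} : Step l g (.star k) none l g (some .one)
  | seqOne {l g k} : Step l g (.seq .one k) none l g (some k)
  | seqStep {l g k k' ℓ l' g' k₁} (h : Step l g k ℓ l' g' (some k₁)) :
      Step l g (.seq k k') ℓ l' g' (some (.seq k₁ k'))
  | seqRet {l g k k' ℓ l' g'} (h : Step l g k ℓ l' g' none) :
      Step l g (.seq k k') ℓ l' g' none

/-- Finitely many unlabelled steps followed by one labelled step. -/
inductive BigStep : O.Lo → O.Gl → O.Code → Label O → O.Lo → O.Gl → Option O.Code → Prop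
  | last {l g k ℓ l' g' k'} (h : Step O l g k (some ℓ) l' g' k') : BigStep l g k ℓ l' g' k'
  | silent {l g k l₁ g₁ k₁ ℓ l' g' k'} (h : Step O l g k none l₁ g₁ (some k₁))
      (h' : BigStep l₁ g₁ k₁ ℓ l' g' k') : BigStep l g k ℓ l' g' k'

/-- A configuration: the shared state and, for each thread invoked so far, its local state and the
code it still has to run. -/
structure Config where
  gl : O.Gl
  thr : T → Option (O.Lo × Option O.Code)

/-- The initial configuration: no thread has been invoked. -/
def Config.init : Config O := ⟨O.initGl, fun _ => none⟩

/-- Every invoked thread has returned. -/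
def Config.Final {O : ConcObject.{u, v, w} T} (C : Config O) : Prop :=
  ∀ t l k, C.thr t = some (l, k) → k = none

/-- An environment says which threads invoke which method with which arguments, one invocation
per thread. It need not be finite: an execution is finite and so involves finitely many threads. -/
abbrev Env : Type (max u v) := T → Option ((m : O.Meth) × O.Arg m)

/-- Transitions between configurations, labelled with a thread and a label. -/
inductive Trans [DecidableEq T] (env : Env O) : Config O → T × Label O → Config O → Prop
  | inv {C : Config O} {t m x} (he : env t = some ⟨m, x⟩) (ht : C.thr t = none) :
      Trans env C (t, .inv m x)
        ⟨C.gl, Function.update C.thr t (some (O.initLo t m x, some (O.code m)))⟩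
  | step {C : Config O} {t l k ℓ l' g' k'} (ht : C.thr t = some (l, some k))
      (h : BigStep O l C.gl k ℓ l' g' k') :
      Trans env C (t, ℓ) ⟨g', Function.update C.thr t (some (l', k'))⟩

/-- An execution `C₀ ⇒ C₁ ⇒ ⋯ ⇒ Cₙ` from the initial configuration, where `n` is the length of its
trace (`conf i` is irrelevant for `i > n`). -/
structure Execution [DecidableEq T] (env : Env O) where
  trace : List (T × Label O)
  conf : ℕ → Config O
  init : conf 0 = Config.init O
  step : ∀ (i : ℕ) (h : i < trace.length), Trans O env (conf i) (trace)[i] (conf (i + 1))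

/-- The execution ends in a final configuration. -/
def Execution.Completed [DecidableEq T] {O : ConcObject.{u, v, w} T} {env : Env O}
    (ρ : Execution O env) : Prop :=
  (ρ.conf ρ.trace.length).Final

/-- The semantics of an object: traces of completed executions under all environments. -/
def ConcObject.traces [DecidableEq T] : Set (List (T × Label O)) :=
  {τ | ∃ (env : Env O) (ρ : Execution O env), ρ.Completed ∧ ρ.trace = τ}

end Semantics

/-! ### Linearizability -/

/-- An operation symbol `m(x)/r`. -/
structure OpSym (Meth : Type) (Arg : Meth → Type v) (Ret : Type v) where
  meth : Meth
  arg : Arg meth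
  ret : Ret

section Linearizability

variable {T : Type u} {O : ConcObject.{u, v, w} T}

/-- `o` is the operation performed by thread `t` in the trace `τ`. -/
def OperationOf (τ : List (T × Label O)) (t : T) (o : OpSym O.Meth O.Arg O.Ret) : Prop :=
  (t, Label.inv o.meth o.arg) ∈ τ ∧ (t, Label.ret o.ret) ∈ τ

/-- `lp` maps threads to positions of their linearization points in `τ`, and `ts` lists the invoked
threads in a linearization order induced by `lp`, whose operations form a sequence in `S`. Two
threads may be linearized at the same position; `ts` then fixes their order. -/
structure IsLinearization (S : Set (List (OpSym O.Meth O.Arg O.Ret))) (τ : List (T × Label O))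
    (lp : T → ℕ) (ts : List T) : Prop where
  nodup : ts.Nodup
  mem_iff : ∀ t, t ∈ ts ↔ ∃ m x, (t, Label.inv m x) ∈ τ
  sorted : ts.Pairwise fun s t => lp s ≤ lp t
  between : ∀ t ∈ ts, ∃ i j m x r, i < lp t ∧ lp t < j ∧
    τ[i]? = some (t, Label.inv m x) ∧ τ[j]? = some (t, Label.ret r)
  spec : ∃ os ∈ S, List.Forall₂ (OperationOf τ) ts os

/-- A trace is linearizable with respect to the sequential specification `S`. -/
def LinearizableTrace (S : Set (List (OpSym O.Meth O.Arg O.Ret))) (τ : List (T × Label O)) : Prop :=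
  ∃ lp ts, IsLinearization S τ lp ts

/-- An object is linearizable with respect to `S` if all its traces are. -/
def Linearizable [DecidableEq T] (O : ConcObject.{u, v, w} T)
    (S : Set (List (OpSym O.Meth O.Arg O.Ret))) : Prop :=
  ∀ τ ∈ O.traces, LinearizableTrace S τ

end Linearizability

/-! ### The sequential stack -/

inductive StackMeth : Type
  | push
  | pop

/-- `push` takes a value, `pop` takes nothing. -/
def StackArg (Val : Type v) : StackMeth → Type v
  | .push => Val
  | .pop => PUnit

/-- Operation symbols of a stack; `push` returns `none` (NULL) and `pop` returns `some v`. -/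
abbrev StackOp (Val : Type v) : Type v := OpSym StackMeth (StackArg Val) (Option Val)

/-- The operations can be executed one after the other from the stack `s` (top first). A `pop` on
the empty stack leaves it empty and returns `empty`. -/
def StackRun {Val : Type v} (empty : Val) : List Val → List (StackOp Val) → Prop
  | _, [] => True
  | s, ⟨.push, x, r⟩ :: os => r = none ∧ StackRun empty ((x : Val) :: s) os
  | [], ⟨.pop, _, r⟩ :: os => r = some empty ∧ StackRun empty [] os
  | y :: s, ⟨.pop, _, r⟩ :: os => r = some y ∧ StackRun empty s os

/-- The sequential specification of an initially empty stack. -/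
def stackSpec {Val : Type v} (empty : Val) : Set (List (StackOp Val)) :=
  {os | StackRun empty [] os}

/-! ### The elimination stack -/

/-- A descriptor `(op, id, input)`; `input` is `none` for a pop. -/
structure Desc (T : Type u) (Val : Type v) where
  op : StackMeth
  id : T
  input : Option Val

/-- A list node; pointers are optional addresses, `none` being NULL. -/
structure Node (Val : Type v) where
  val : Option Val
  next : Option ℕ

/-- Shared state. `heap a = none` means that the address `a` was never allocated. -/
structure Shared (T : Type u) (Val : Type v) where
  top : Option ℕ
  heap : ℕ → Option (Node Val)
  location : T → Option (Desc T Val)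
  collision : ℤ → Option T

/-- Local variables of an invocation. -/
structure Locals (T : Type u) (Val : Type v) where
  mytid : T
  p : Desc T Val
  n : Option ℕ
  oldTop : Option ℕ
  newTop : Option ℕ
  pos : ℤ
  him : Option T
  q : Option (Desc T Val)
  val : Option Val

/-- Primitive actions. Below, `x/y` means `x` for a push and `y` for a pop. -/
inductive SAct : Type
  | malloc -- n = malloc(...)
  | setVal -- n->val = p.input
  | readTop -- oldTop = top
  | setNext -- n->next = oldTop
  | topToN -- top = n
  | readNext -- newTop = oldTop->next
  | topToNew -- top = newTop
  | readVal -- val = oldTop->val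
  | publish -- location[mytid] = p
  | choosePos -- pos = nondet()
  | readCollision -- him = collision[pos]
  | setCollision -- collision[pos] = mytid
  | readHim -- q = location[him]
  | clearMine -- location[mytid] = NULL
  | setHim -- location[him] = p/NULL
  | readMine -- val = NULL/location[mytid].input

/-- Primitive tests. -/
inductive STest : Type
  | topEqOld -- top == oldTop
  | oldTopNull -- oldTop == NULL
  | collisionEqHim -- collision[pos] == him
  | himNull -- him == NULL
  | qNull -- q == NULL
  | qIdHim -- q.id == him
  | opDiff -- p.op != q.op
  | mineEqP -- location[mytid] == p
  | himEqQ -- location[him] == q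

/-- Return expressions. -/
inductive SRet : Type
  | null -- NULL
  | empty -- the value that signals an empty stack
  | val -- val
  | matched -- NULL/q.input

section ElimStack

variable {T : Type u} {Val : Type v} [DecidableEq T]

/-- The node a pointer points to, if any. -/
def Shared.deref (g : Shared T Val) (ptr : Option ℕ) : Option (Node Val) := ptr.bind g.heap

/-- Modify the node that a pointer points to. -/
def Shared.modifyNode (g : Shared T Val) (ptr : Option ℕ) (f : Node Val → Node Val) :
    Shared T Val :=
  match ptr with
  | none => g
  | some a => { g with heap := Function.update g.heap a ((g.heap a).map f) }

/-- `x/y`: the first alternative in a push, the second in a pop. -/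
def Locals.pushPop {α : Type*} (l : Locals T Val) (x y : α) : α :=
  match l.p.op with
  | .push => x
  | .pop => y

/-- Meaning of the actions. Memory is garbage collected: an allocation takes an arbitrary address
that was never allocated before, with arbitrary initial contents. -/
def sActSem : SAct → Locals T Val → Shared T Val → Locals T Val → Shared T Val → Prop
  | .malloc, l, g, l', g' => ∃ a node, g.heap a = none ∧
      l' = { l with n := some a } ∧ g' = { g with heap := Function.update g.heap a (some node) }
  | .setVal, l, g, l', g' =>
      l' = l ∧ g' = g.modifyNode l.n fun d => { d with val := l.p.input }
  | .readTop, l, g, l', g' => l' = { l with oldTop := g.top } ∧ g' = g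
  | .setNext, l, g, l', g' =>
      l' = l ∧ g' = g.modifyNode l.n fun d => { d with next := l.oldTop }
  | .topToN, l, g, l', g' => l' = l ∧ g' = { g with top := l.n }
  | .readNext, l, g, l', g' =>
      l' = { l with newTop := (g.deref l.oldTop).bind Node.next } ∧ g' = g
  | .topToNew, l, g, l', g' => l' = l ∧ g' = { g with top := l.newTop }
  | .readVal, l, g, l', g' =>
      l' = { l with val := (g.deref l.oldTop).bind Node.val } ∧ g' = g
  | .publish, l, g, l', g' =>
      l' = l ∧ g' = { g with location := Function.update g.location l.mytid (some l.p) }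
  | .choosePos, l, g, l', g' => (∃ i : ℤ, l' = { l with pos := i }) ∧ g' = g
  | .readCollision, l, g, l', g' => l' = { l with him := g.collision l.pos } ∧ g' = g
  | .setCollision, l, g, l', g' =>
      l' = l ∧ g' = { g with collision := Function.update g.collision l.pos (some l.mytid) }
  | .readHim, l, g, l', g' => l' = { l with q := l.him.bind g.location } ∧ g' = g
  | .clearMine, l, g, l', g' =>
      l' = l ∧ g' = { g with location := Function.update g.location l.mytid none }
  | .setHim, l, g, l', g' => l' = l ∧ ∃ h, l.him = some h ∧
      g' = { g with location := Function.update g.location h (l.pushPop (some l.p) none) }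
  | .readMine, l, g, l', g' =>
      l' = { l with val := l.pushPop none ((g.location l.mytid).bind Desc.input) } ∧ g' = g

/-- Meaning of the tests. -/
def sTestSem : STest → Locals T Val → Shared T Val → Prop
  | .topEqOld, l, g => g.top = l.oldTop
  | .oldTopNull, l, _ => l.oldTop = none
  | .collisionEqHim, l, g => g.collision l.pos = l.him
  | .himNull, l, _ => l.him = none
  | .qNull, l, _ => l.q = none
  | .qIdHim, l, _ => ∃ d, l.q = some d ∧ l.him = some d.id
  | .opDiff, l, _ => ∃ d, l.q = some d ∧ l.p.op ≠ d.op
  | .mineEqP, l, g => g.location l.mytid = some l.p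
  | .himEqQ, l, g => l.him.bind g.location = l.q

/-- Meaning of the return expressions. -/
def sRetSem (empty : Val) : SRet → Locals T Val → Option Val
  | .null, _ => none
  | .empty, _ => some empty
  | .val, l => l.val
  | .matched, l => l.pushPop none (l.q.bind Desc.input)

abbrev SCode : Type := Kat SAct STest SRet

/-- One iteration of the loop of Treiber's stack. -/
def treiberIter : StackMeth → SCode
  | .push =>
    .act .malloc ⬝ .act .setVal ⬝ .act .readTop ⬝ .act .setNext ⬝
      (.arw (.prim .topEqOld) .topToN ⬝ .ret .null ⊹
       .test (.not (.prim .topEqOld)))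
  | .pop =>
    .act .readTop ⬝
      (.test (.prim .oldTopNull) ⬝ .ret .empty ⊹
       .test (.not (.prim .oldTopNull)) ⬝ .act .readNext ⬝
         (.arw (.prim .topEqOld) .topToNew ⬝ .act .readVal ⬝ .ret .val ⊹
          .test (.not (.prim .topEqOld))))

/-- `val = NULL/location[mytid].input; location[mytid] = NULL; return val` -/
def finishCode : SCode := .act .readMine ⬝ .act .clearMine ⬝ .ret .val

/-- `if (!CAS(&location[mytid], p, NULL)) { finish }` -/
def clearCode : SCode :=
  .arw (.prim .mineEqP) .clearMine ⊹
  .test (.not (.prim .mineEqP)) ⬝ finishCode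

/-- `do { him = collision[pos] } while (!CAS(&collision[pos], him, mytid))` -/
def announceCode : SCode :=
  .act .readCollision ⬝
    .star (.test (.not (.prim .collisionEqHim)) ⬝ .act .readCollision) ⬝
    .arw (.prim .collisionEqHim) .setCollision

/-- `q != NULL & q.id = him & p.op != q.op` -/
def canCollide : BExp STest := .and (.not (.prim .qNull)) (.and (.prim .qIdHim) (.prim .opDiff))

/-- The two CASs of the initiator of a collision. -/
def collideCode : SCode :=
  .arw (.prim .mineEqP) .clearMine ⬝
    (.arw (.prim .himEqQ) .setHim ⬝ .ret .matched ⊹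
     .test (.not (.prim .himEqQ))) ⊹
  .test (.not (.prim .mineEqP)) ⬝ finishCode

/-- The collision protocol that follows a failed iteration of Treiber's stack. -/
def eliminationIter : SCode :=
  .act .publish ⬝ .act .choosePos ⬝ announceCode ⬝
    (.test (.not (.prim .himNull)) ⬝ .act .readHim ⬝
       (.test canCollide ⬝ collideCode ⊹
        .test (.not canCollide) ⬝ clearCode) ⊹
     .test (.prim .himNull) ⬝ clearCode)

/-- The elimination stack, with `empty` the value returned by a pop that finds the stack empty. -/
def elimStack (T : Type u) {Val : Type v} [DecidableEq T] (empty : Val) :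
    ConcObject.{u, v, max u v} T where
  Meth := StackMeth
  Arg := StackArg Val
  Ret := Option Val
  Act := SAct
  Test := STest
  RetExp := SRet
  Lo := Locals T Val
  Gl := Shared T Val
  actSem := sActSem
  testSem := sTestSem
  retSem := sRetSem empty
  initGl := ⟨none, fun _ => none, fun _ => none, fun _ => none⟩
  initLo t m x :=
    { mytid := t
      p := ⟨m, t, match m, x with
        | .push, x => some x
        | .pop, _ => none⟩
      n := none, oldTop := none, newTop := none, pos := 0, him := none, q := none, val := none }
  code m := .star (treiberIter m ⬝ eliminationIter)

/-! ### Linearization points of the elimination stack -/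

variable {empty : Val} {env : Env (elimStack T empty)}

/-- The `k`-th step is a successful CAS on `top` by thread `t`. -/
def TopCASAt (ρ : Execution (elimStack T empty) env) (k : ℕ) (t : T) : Prop :=
  ρ.trace[k]? = some (t, Label.arw (.prim STest.topEqOld) SAct.topToN) ∨
  ρ.trace[k]? = some (t, Label.arw (.prim STest.topEqOld) SAct.topToNew)

/-- Thread `t` performs a pop that returns `empty`, and the `k`-th step is its read of NULL from
`top`. -/
def EmptyReadAt (ρ : Execution (elimStack T empty) env) (k : ℕ) (t : T) : Prop :=
  OperationOf ρ.trace t ⟨StackMeth.pop, PUnit.unit, some empty⟩ ∧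
  ρ.trace[k]? = some (t, Label.act SAct.readTop) ∧ (ρ.conf k).gl.top = none

/-- The `k`-th step is the successful second CAS of a collision in which `a` is the initiator
(active) and `b` is the thread whose `location` cell is modified (passive). -/
def CollisionAt (ρ : Execution (elimStack T empty) env) (k : ℕ) (a b : T) : Prop :=
  ρ.trace[k]? = some (a, Label.arw (.prim STest.himEqQ) SAct.setHim) ∧
  ∃ l c, (ρ.conf k).thr a = some (l, c) ∧ l.him = some b

/-- Thread `t` invokes the method `m` in `ρ`. -/
def Invokes (ρ : Execution (elimStack T empty) env) (t : T) (m : StackMeth) : Prop :=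
  ∃ x, (t, Label.inv m x) ∈ ρ.trace

/-- The linearization points are exactly the successful CASs on `top`, the reads of an empty `top`
and the successful second CASs of collisions; each collision linearizes both of its threads, one a
push and the other a pop, the push immediately followed by the pop. -/
structure HasElimLinPoints (ρ : Execution (elimStack T empty) env) (lp : T → ℕ) (ts : List T) :
    Prop where
  cases : ∀ t ∈ ts, TopCASAt ρ (lp t) t ∨ EmptyReadAt ρ (lp t) t ∨
    ∃ a b, CollisionAt ρ (lp t) a b ∧ (t = a ∨ t = b)
  topCAS : ∀ k t, TopCASAt ρ k t → lp t = k
  collision : ∀ k a b, CollisionAt ρ k a b → lp a = k ∧ lp b = k ∧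
    ∃ s t, (s = a ∧ t = b ∨ s = b ∧ t = a) ∧ Invokes ρ s .push ∧ Invokes ρ t .pop ∧
      ∃ ts₁ ts₂, ts = ts₁ ++ s :: t :: ts₂

end ElimStack

end KatObj

/-! The proof runs the execution alongside auxiliary state: the list `ts` of threads linearized so
far, the result `res` each of them is bound to return, and the owner of every node that is not yet
public. The list grows exactly at the linearization points, and the invariant `ConfInv` says that
the operations in `ts`, with their promised results, form a legal sequential run whose final stack
is the list of public nodes reachable from `top`.

For Treiber's part, a node is modified only by its owner, and allocation never reuses an address. A
public node is therefore immutable, which excludes the ABA problem: if the CAS of a pop succeeds,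
the `next` field read earlier is still that of the top node. The CAS of a push publishes a node
whose `next` field is the current top. A pop that reads NULL is linearized at that read.

For the collisions, `location[b]` holds a descriptor with id `b` only while `b` waits for a partner
and is not linearized (`PC.Inv.awaiting`). So if the second CAS of `a` on `location[b]` succeeds,
`b` is still free; `a` has withdrawn its own descriptor and cannot be chosen by a third thread.
Linearizing the push and then the pop leaves the stack unchanged. From then on the cell of `b` holds
NULL or the descriptor of `a`, so the attempt of `b` to withdraw fails and `b` finds its result in
the cell.

The code is reduced to a finite control flow graph by derivatives (`PC.derivs_code`). Each control
point has an assertion about its thread alone, stable under the steps of the others (`PC.Inv.mono`),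
and each step either linearizes nothing or is a linearization point (`PC.Inv.step_cases`).
`ConfInv.trans` shows preservation. `History.succ` lets `lp` record the index of the step at which a
thread enters `ts`; this lies after its invocation, since only invoked threads are linearized, and
before its return, since a thread returns only a promised result. -/

namespace KatObj

/-! ### Partial derivatives of KAT expressions -/

/-- A labelled instruction of a KAT expression. -/
inductive Instr (A B E : Type) : Type
  | act (a : A)
  | test (b : BExp B)
  | arw (b : BExp B) (a : A)
  | ret (e : E)

/-- The expression can terminate without executing an instruction. -/
def Kat.nullable {A B E : Type} : Kat A B E → Bool
  | .act _ | .test _ | .arw _ _ | .ret _ | .zero => false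
  | .seq k k' => k.nullable && k'.nullable
  | .plus k k' => k.nullable || k'.nullable
  | .star _ | .one => true

/-- The possible first instructions, each with the code that remains after it. -/
def Kat.derivs {A B E : Type} : Kat A B E → List (Instr A B E × Option (Kat A B E))
  | .act a => [(.act a, some .one)]
  | .test b => [(.test b, some .one)]
  | .arw b a => [(.arw b a, some .one)]
  | .ret e => [(.ret e, none)]
  | .seq k k' => k.derivs.map (fun x => (x.1, x.2.map fun k₁ => .seq k₁ k')) ++
      if k.nullable then k'.derivs else []
  | .plus k k' => k.derivs ++ k'.derivs
  | .star k => k.derivs.map fun x => (x.1, x.2.map fun k₁ => .seq k₁ (.star k))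
  | .zero | .one => []

section Derivatives

variable {T : Type u} {O : ConcObject.{u, v, w} T}

/-- Meaning of an instruction, together with the label that it produces. -/
def Instr.Exec (O : ConcObject.{u, v, w} T) :
    Instr O.Act O.Test O.RetExp → O.Lo → O.Gl → Label O → O.Lo → O.Gl → Prop
  | .act a, l, g, ℓ, l', g' => ℓ = .act a ∧ O.actSem a l g l' g'
  | .test b, l, g, ℓ, l', g' => ℓ = .test b ∧ (b.Holds fun c => O.testSem c l g) ∧ l' = l ∧ g' = g
  | .arw b a, l, g, ℓ, l', g' =>
      ℓ = .arw b a ∧ (b.Holds fun c => O.testSem c l g) ∧ O.actSem a l g l' g'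
  | .ret e, l, g, ℓ, l', g' => ℓ = .ret (O.retSem e l) ∧ l' = l ∧ g' = g

/-- An unlabelled step only resolves choices, so it can lose first instructions but not create any.
Nullability is carried along because in a sequence it decides whether the first instructions of the
second part are exposed. -/
theorem Step.silent_derivs {l l' : O.Lo} {g g' : O.Gl} {k : O.Code} {ℓ : Option (Label O)}
    {r : Option O.Code} (h : Step O l g k ℓ l' g' r) (hℓ : ℓ = none) :
    l' = l ∧ g' = g ∧ ∃ k', r = some k' ∧ k'.derivs ⊆ k.derivs ∧
      (k'.nullable = true → k.nullable = true) := by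
  induction h with
  | act | test | arw | ret => cases hℓ
  | plusLeft => exact ⟨rfl, rfl, _, rfl, by simp [Kat.derivs], by simp +contextual [Kat.nullable]⟩
  | plusRight => exact ⟨rfl, rfl, _, rfl, by simp [Kat.derivs], by simp +contextual [Kat.nullable]⟩
  | @starUnfold k =>
    refine ⟨rfl, rfl, _, rfl, ?_, by simp [Kat.nullable]⟩
    cases hk : k.nullable <;> simp [Kat.derivs, hk]
  | starExit => exact ⟨rfl, rfl, _, rfl, by simp [Kat.derivs], by simp [Kat.nullable]⟩
  | seqOne =>
    exact ⟨rfl, rfl, _, rfl, by simp [Kat.derivs, Kat.nullable], by simp [Kat.nullable]⟩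
  | seqStep h ih =>
    obtain ⟨rfl, rfl, k₂, hk₂, hd, hn⟩ := ih hℓ
    cases hk₂
    refine ⟨rfl, rfl, _, rfl, ?_, ?_⟩
    · simp only [Kat.derivs]
      refine List.append_subset.2 ⟨List.Subset.trans (List.map_subset _ hd)
        (List.subset_append_left _ _), ?_⟩
      split
      · rename_i hk
        rw [if_pos (hn hk)]
        exact List.subset_append_right _ _
      · simp
    · simp only [Kat.nullable, Bool.and_eq_true]
      exact fun hk => ⟨hn hk.1, hk.2⟩
  | seqRet h ih =>
    obtain ⟨_, _, k₂, hk₂, _⟩ := ih hℓ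
    cases hk₂

theorem Step.exec_derivs {l l' : O.Lo} {g g' : O.Gl} {k : O.Code} {ℓ : Option (Label O)}
    {r : Option O.Code} (h : Step O l g k ℓ l' g' r) {ℓ₀ : Label O} (hℓ : ℓ = some ℓ₀) :
    ∃ i, (i, r) ∈ k.derivs ∧ Instr.Exec O i l g ℓ₀ l' g' := by
  induction h with
  | act h => cases hℓ; exact ⟨_, List.mem_singleton.2 rfl, rfl, h⟩
  | test h => cases hℓ; exact ⟨_, List.mem_singleton.2 rfl, rfl, h, rfl, rfl⟩
  | arw hb ha => cases hℓ; exact ⟨_, List.mem_singleton.2 rfl, rfl, hb, ha⟩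
  | ret => cases hℓ; exact ⟨_, List.mem_singleton.2 rfl, rfl, rfl, rfl⟩
  | plusLeft | plusRight | starUnfold | starExit | seqOne => cases hℓ
  | seqStep h ih =>
    obtain ⟨i, hi, he⟩ := ih hℓ
    exact ⟨i, List.mem_append_left _ (List.mem_map.2 ⟨_, hi, rfl⟩), he⟩
  | seqRet h ih =>
    obtain ⟨i, hi, he⟩ := ih hℓ
    exact ⟨i, List.mem_append_left _ (List.mem_map.2 ⟨_, hi, rfl⟩), he⟩

/-- Every labelled step executes one of the first instructions of the code. -/
theorem BigStep.exec_derivs {l l' : O.Lo} {g g' : O.Gl} {k : O.Code} {ℓ : Label O}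
    {r : Option O.Code} (h : BigStep O l g k ℓ l' g' r) :
    ∃ i, (i, r) ∈ k.derivs ∧ Instr.Exec O i l g ℓ l' g' := by
  induction h with
  | last h => exact h.exec_derivs rfl
  | silent h _ ih =>
    obtain ⟨rfl, rfl, _, hk, hd, -⟩ := h.silent_derivs rfl
    cases hk
    obtain ⟨i, hi, he⟩ := ih
    exact ⟨i, hd hi, he⟩

end Derivatives

/-! ### Control flow graph of the elimination stack -/

/-- Control points of the elimination stack, named after the last instruction executed. -/
inductive PC : Type
  | start | restart
  | pushMalloc | pushSetVal | pushReadTop | pushSetNext | pushCAS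
  | popReadTop | popNull | popNonNull | popReadNext | popCAS | popReadVal
  | failed
  | published | chosen | collisionRead | collisionChanged | collisionReread | announced
  | himFound | himRead | colliding | clearing
  | firstCAS | secondCAS
  | finishing | mineRead | mineCleared

/-- The main loop. -/
def loopCode (m : StackMeth) : SCode := .star (treiberIter m ⬝ eliminationIter)

def announceLoop : SCode := .star (.test (.not (.prim .collisionEqHim)) ⬝ .act .readCollision)

def announceCAS : SCode := .arw (.prim .collisionEqHim) .setCollision

def meetCode : SCode :=
  .act .readHim ⬝ (.test canCollide ⬝ collideCode ⊹ .test (.not canCollide) ⬝ clearCode)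

def afterAnnounce : SCode :=
  .test (.not (.prim .himNull)) ⬝ meetCode ⊹ .test (.prim .himNull) ⬝ clearCode

/-- The code that remains at a control point. -/
def PC.code (m : StackMeth) : PC → SCode
  | start => loopCode m
  -- Derivatives leave a leading `.one` and different bracketings behind; this is why `start` and
  -- `restart`, or `collisionRead` and `collisionReread`, are separate control points with the same
  -- successors.
  | restart => .one ⬝ loopCode m
  | pushMalloc => ((.one ⬝ .act .setVal ⬝ .act .readTop ⬝ .act .setNext ⬝
      (.arw (.prim .topEqOld) .topToN ⬝ .ret .null ⊹ .test (.not (.prim .topEqOld)))) ⬝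
      eliminationIter) ⬝ loopCode m
  | pushSetVal => ((.one ⬝ .act .readTop ⬝ .act .setNext ⬝
      (.arw (.prim .topEqOld) .topToN ⬝ .ret .null ⊹ .test (.not (.prim .topEqOld)))) ⬝
      eliminationIter) ⬝ loopCode m
  | pushReadTop => ((.one ⬝ .act .setNext ⬝
      (.arw (.prim .topEqOld) .topToN ⬝ .ret .null ⊹ .test (.not (.prim .topEqOld)))) ⬝
      eliminationIter) ⬝ loopCode m
  | pushSetNext => ((.one ⬝
      (.arw (.prim .topEqOld) .topToN ⬝ .ret .null ⊹ .test (.not (.prim .topEqOld)))) ⬝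
      eliminationIter) ⬝ loopCode m
  | pushCAS => ((.one ⬝ .ret .null) ⬝ eliminationIter) ⬝ loopCode m
  | popReadTop => ((.one ⬝ (.test (.prim .oldTopNull) ⬝ .ret .empty ⊹
       .test (.not (.prim .oldTopNull)) ⬝ .act .readNext ⬝
         (.arw (.prim .topEqOld) .topToNew ⬝ .act .readVal ⬝ .ret .val ⊹
          .test (.not (.prim .topEqOld))))) ⬝ eliminationIter) ⬝ loopCode m
  | popNull => ((.one ⬝ .ret .empty) ⬝ eliminationIter) ⬝ loopCode m
  | popNonNull => ((.one ⬝ .act .readNext ⬝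
         (.arw (.prim .topEqOld) .topToNew ⬝ .act .readVal ⬝ .ret .val ⊹
          .test (.not (.prim .topEqOld)))) ⬝ eliminationIter) ⬝ loopCode m
  | popReadNext => ((.one ⬝
         (.arw (.prim .topEqOld) .topToNew ⬝ .act .readVal ⬝ .ret .val ⊹
          .test (.not (.prim .topEqOld)))) ⬝ eliminationIter) ⬝ loopCode m
  | popCAS => ((.one ⬝ .act .readVal ⬝ .ret .val) ⬝ eliminationIter) ⬝ loopCode m
  | popReadVal => ((.one ⬝ .ret .val) ⬝ eliminationIter) ⬝ loopCode m
  | failed => (.one ⬝ eliminationIter) ⬝ loopCode m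
  | published => (.one ⬝ .act .choosePos ⬝ announceCode ⬝ afterAnnounce) ⬝ loopCode m
  | chosen => (.one ⬝ announceCode ⬝ afterAnnounce) ⬝ loopCode m
  | collisionRead => ((.one ⬝ announceLoop ⬝ announceCAS) ⬝ afterAnnounce) ⬝ loopCode m
  | collisionChanged =>
      ((((.one ⬝ .act .readCollision) ⬝ announceLoop) ⬝ announceCAS) ⬝ afterAnnounce) ⬝ loopCode m
  | collisionReread => (((.one ⬝ announceLoop) ⬝ announceCAS) ⬝ afterAnnounce) ⬝ loopCode m
  | announced => (.one ⬝ afterAnnounce) ⬝ loopCode m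
  | himFound => (.one ⬝ meetCode) ⬝ loopCode m
  | himRead => (.one ⬝
      (.test canCollide ⬝ collideCode ⊹ .test (.not canCollide) ⬝ clearCode)) ⬝ loopCode m
  | colliding => (.one ⬝ collideCode) ⬝ loopCode m
  | clearing => (.one ⬝ clearCode) ⬝ loopCode m
  | firstCAS => (.one ⬝ (.arw (.prim .himEqQ) .setHim ⬝ .ret .matched ⊹
      .test (.not (.prim .himEqQ)))) ⬝ loopCode m
  | secondCAS => (.one ⬝ .ret .matched) ⬝ loopCode m
  | finishing => (.one ⬝ finishCode) ⬝ loopCode m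
  | mineRead => (.one ⬝ .act .clearMine ⬝ .ret .val) ⬝ loopCode m
  | mineCleared => (.one ⬝ .ret .val) ⬝ loopCode m

abbrev SInstr : Type := Instr SAct STest SRet

/-- The edges of the control flow graph. -/
def PC.next (m : StackMeth) : PC → List (SInstr × Option PC)
  | start | restart => match m with
    | .push => [(.act .malloc, some pushMalloc)]
    | .pop => [(.act .readTop, some popReadTop)]
  | pushMalloc => [(.act .setVal, some pushSetVal)]
  | pushSetVal => [(.act .readTop, some pushReadTop)]
  | pushReadTop => [(.act .setNext, some pushSetNext)]
  | pushSetNext => [(.arw (.prim .topEqOld) .topToN, some pushCAS),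
      (.test (.not (.prim .topEqOld)), some failed)]
  | pushCAS => [(.ret .null, none)]
  | popReadTop => [(.test (.prim .oldTopNull), some popNull),
      (.test (.not (.prim .oldTopNull)), some popNonNull)]
  | popNull => [(.ret .empty, none)]
  | popNonNull => [(.act .readNext, some popReadNext)]
  | popReadNext => [(.arw (.prim .topEqOld) .topToNew, some popCAS),
      (.test (.not (.prim .topEqOld)), some failed)]
  | popCAS => [(.act .readVal, some popReadVal)]
  | popReadVal => [(.ret .val, none)]
  | failed => [(.act .publish, some published)]
  | published => [(.act .choosePos, some chosen)]
  | chosen => [(.act .readCollision, some collisionRead)]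
  | collisionRead | collisionReread =>
      [(.test (.not (.prim .collisionEqHim)), some collisionChanged),
        (.arw (.prim .collisionEqHim) .setCollision, some announced)]
  | collisionChanged => [(.act .readCollision, some collisionReread)]
  | announced => [(.test (.not (.prim .himNull)), some himFound),
      (.test (.prim .himNull), some clearing)]
  | himFound => [(.act .readHim, some himRead)]
  | himRead => [(.test canCollide, some colliding), (.test (.not canCollide), some clearing)]
  | colliding => [(.arw (.prim .mineEqP) .clearMine, some firstCAS),
      (.test (.not (.prim .mineEqP)), some finishing)]
  | clearing => [(.arw (.prim .mineEqP) .clearMine, some restart),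
      (.test (.not (.prim .mineEqP)), some finishing)]
  | firstCAS => [(.arw (.prim .himEqQ) .setHim, some secondCAS),
      (.test (.not (.prim .himEqQ)), some restart)]
  | secondCAS => [(.ret .matched, none)]
  | finishing => [(.act .readMine, some mineRead)]
  | mineRead => [(.act .clearMine, some mineCleared)]
  | mineCleared => [(.ret .val, none)]

/-- The control points are closed under derivatives, so no other code is ever reached. Both sides
are explicit finite lists, equal by computation. -/
theorem PC.derivs_code (m : StackMeth) (pc : PC) :
    (pc.code m).derivs = (pc.next m).map fun x => (x.1, x.2.map (PC.code m)) := by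
  cases pc <;> cases m <;> rfl

section

variable {T : Type u} {Val : Type v} [DecidableEq T] {empty : Val}

/-- `Instr.Exec` for the elimination stack. -/
def SInstr.Exec (empty : Val) : SInstr → Locals T Val → Shared T Val → Label (elimStack T empty) →
    Locals T Val → Shared T Val → Prop
  | .act a, l, g, ℓ, l', g' => ℓ = Label.act (O := elimStack T empty) a ∧ sActSem a l g l' g'
  | .test b, l, g, ℓ, l', g' => ℓ = Label.test (O := elimStack T empty) b ∧
      (b.Holds fun c => sTestSem c l g) ∧ l' = l ∧ g' = g
  | .arw b a, l, g, ℓ, l', g' => ℓ = Label.arw (O := elimStack T empty) b a ∧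
      (b.Holds fun c => sTestSem c l g) ∧ sActSem a l g l' g'
  | .ret e, l, g, ℓ, l', g' =>
      ℓ = Label.ret (O := elimStack T empty) (sRetSem empty e l) ∧ l' = l ∧ g' = g

theorem BigStep.exec_next {l l' : Locals T Val} {g g' : Shared T Val} {m : StackMeth} {pc : PC}
    {ℓ : Label (elimStack T empty)} {r : Option SCode}
    (h : BigStep (elimStack T empty) l g (pc.code m) ℓ l' g' r) :
    ∃ i pc', (i, pc') ∈ pc.next m ∧ r = pc'.map (PC.code m) ∧ SInstr.Exec empty i l g ℓ l' g' := by
  -- `Instr.Exec` and `SInstr.Exec` unfold to the same proposition once the instruction is a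
  -- constructor.
  have aux : ∃ i : SInstr, (i, r) ∈ (pc.code m).derivs ∧ SInstr.Exec empty i l g ℓ l' g' := by
    obtain ⟨i, hi, he⟩ := h.exec_derivs
    refine ⟨i, hi, ?_⟩
    cases i <;> exact he
  obtain ⟨i, hi, he⟩ := aux
  rw [PC.derivs_code, List.mem_map] at hi
  obtain ⟨⟨i', pc'⟩, hmem, heq⟩ := hi
  cases heq
  exact ⟨i', pc', hmem, rfl, he⟩

end

/-! ### Invariant of the threads -/

/-- Auxiliary state: the threads linearized so far in linearization order, the return values they
are bound to produce, and the threads that own the nodes not yet pushed. -/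
structure Ghost (T : Type u) (Val : Type v) where
  ts : List T
  res : T → Option (Option Val)
  owner : ℕ → Option T

section ThreadInvariant

variable {T : Type u} {Val : Type v}

/-- The address `a` holds the node `d` and has owner `o`; public nodes have no owner. -/
def Owns (g : Shared T Val) (γ : Ghost T Val) (o : Option T) (a : ℕ) (d : Node Val) : Prop :=
  γ.owner a = o ∧ g.heap a = some d

/-- The thread is neither linearized nor visible to others. -/
def Unlin (t : T) (g : Shared T Val) (γ : Ghost T Val) : Prop :=
  γ.res t = none ∧ g.location t = none

/-- The thread was linearized as the passive party of a collision. -/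
def Collided (t : T) (l : Locals T Val) (g : Shared T Val) (γ : Ghost T Val) : Prop :=
  γ.res t = some (l.pushPop none ((g.location t).bind Desc.input)) ∧
    -- The cell holds NULL or the descriptor of the partner. Hence `t` cannot withdraw successfully,
    -- and no second initiator can take it for a waiting thread.
    ∀ d, g.location t = some d → d.id ≠ t

/-- The thread has published its descriptor and has not yet tried to withdraw it. -/
def Awaiting (t : T) (l : Locals T Val) (g : Shared T Val) (γ : Ghost T Val) : Prop :=
  γ.res t = none ∧ g.location t = some l.p ∨ Collided t l g γ

/-- The descriptor `q` that was read is that of a thread `him` running the opposite method. -/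
def Opposite (l : Locals T Val) : Prop :=
  ∃ d, l.q = some d ∧ l.him = some d.id ∧ l.p.op ≠ d.op

/-- The invariant of a thread at a control point. -/
def PC.Inv (empty : Val) (t : T) (l : Locals T Val) (g : Shared T Val) (γ : Ghost T Val) :
    PC → Prop
  | start | restart | failed => Unlin t g γ
  | pushMalloc => Unlin t g γ ∧ l.p.op = .push ∧ ∃ a d, l.n = some a ∧ Owns g γ (some t) a d
  | pushSetVal | pushReadTop => Unlin t g γ ∧ l.p.op = .push ∧
      ∃ a d, l.n = some a ∧ Owns g γ (some t) a d ∧ d.val = l.p.input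
  | pushSetNext => Unlin t g γ ∧ l.p.op = .push ∧
      ∃ a d, l.n = some a ∧ Owns g γ (some t) a d ∧ d.val = l.p.input ∧ d.next = l.oldTop
  | pushCAS => g.location t = none ∧ γ.res t = some none
  -- A read of NULL has already fixed the result, before `oldTop` is tested; any other read only
  -- shows that the node is public.
  | popReadTop => g.location t = none ∧ l.p.op = .pop ∧
      (l.oldTop = none ∧ γ.res t = some (some empty) ∨
        γ.res t = none ∧ ∃ a d, l.oldTop = some a ∧ Owns g γ none a d)
  | popNull => g.location t = none ∧ γ.res t = some (some empty)
  | popNonNull => Unlin t g γ ∧ l.p.op = .pop ∧ ∃ a d, l.oldTop = some a ∧ Owns g γ none a d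
  | popReadNext => Unlin t g γ ∧ l.p.op = .pop ∧
      ∃ a d, l.oldTop = some a ∧ Owns g γ none a d ∧ l.newTop = d.next
  | popCAS => g.location t = none ∧
      ∃ a d, l.oldTop = some a ∧ Owns g γ none a d ∧ γ.res t = some d.val
  | popReadVal | mineCleared => g.location t = none ∧ γ.res t = some l.val
  | published | chosen | collisionRead | collisionChanged | collisionReread | announced
  | himFound | himRead | clearing => Awaiting t l g γ
  | colliding => Awaiting t l g γ ∧ Opposite l
  | firstCAS => Unlin t g γ ∧ Opposite l
  | secondCAS => g.location t = none ∧ γ.res t = some (l.pushPop none (l.q.bind Desc.input))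
  | finishing => Collided t l g γ
  | mineRead => γ.res t = some l.val ∧ ∀ d, g.location t = some d → d.id ≠ t

/-- The thread has returned. -/
def Returned (t : T) (g : Shared T Val) (γ : Ghost T Val) : Prop :=
  g.location t = none ∧ ∃ r, γ.res t = some r

/-- The invariant of a thread at a control point, or after its return. -/
def PostInv (empty : Val) (t : T) (l : Locals T Val) (g : Shared T Val) (γ : Ghost T Val) :
    Option PC → Prop
  | some pc => pc.Inv empty t l g γ
  | none => Returned t g γ

/-! ### Stability of the assertions under steps of other threads -/

/-- What the thread `u` relies on is the same in both states. -/
structure SameFor (u : T) (g : Shared T Val) (γ : Ghost T Val) (g' : Shared T Val)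
    (γ' : Ghost T Val) : Prop where
  res : γ'.res u = γ.res u
  loc : g'.location u = g.location u
  pub : ∀ a d, Owns g γ none a d → Owns g' γ' none a d
  own : ∀ a d, Owns g γ (some u) a d → Owns g' γ' (some u) a d

/-- The assertions mention only the thread's own promise, its own `location` cell, its private nodes
and public nodes. -/
theorem PC.Inv.mono {empty : Val} {t : T} {l : Locals T Val} {g g' : Shared T Val}
    {γ γ' : Ghost T Val} {pc : PC} (h : pc.Inv empty t l g γ) (hs : SameFor t g γ g' γ') :
    pc.Inv empty t l g' γ' := by
  have hpub := hs.pub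
  have hown := hs.own
  cases pc <;> simp only [PC.Inv, Unlin, Collided, Awaiting, hs.res, hs.loc] at h ⊢ <;>
    first | exact h | grind

/-- A thread whose own descriptor is in its `location` cell is waiting for a partner. -/
theorem PC.Inv.awaiting {empty : Val} {t : T} {l : Locals T Val} {g : Shared T Val}
    {γ : Ghost T Val} {pc : PC} (h : pc.Inv empty t l g γ) {d : Desc T Val}
    (hd : g.location t = some d) (hid : d.id = t) :
    γ.res t = none ∧ d = l.p ∧ ∀ g' γ', Collided t l g' γ' → pc.Inv empty t l g' γ' := by
  have aux : Awaiting t l g γ → γ.res t = none ∧ d = l.p := by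
    rintro (⟨h₁, h₂⟩ | ⟨-, h₂⟩)
    · exact ⟨h₁, Option.some.inj (hd.symm.trans h₂)⟩
    · exact absurd hid (h₂ d hd)
  cases pc <;> simp only [PC.Inv, Unlin, hd] at h ⊢ <;>
    first
    | exact ⟨(aux h).1, (aux h).2, fun _ _ hc => Or.inr hc⟩
    | exact ⟨(aux h.1).1, (aux h.1).2, fun _ _ hc => ⟨Or.inr hc, h.2⟩⟩
    -- At the remaining control points the cell is NULL or holds a descriptor with another id.
    | (exfalso; grind [Collided])

/-- Effect on the shared state of a step of `t` that linearizes nothing. -/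
structure Frame (t : T) (g : Shared T Val) (γ : Ghost T Val) (g' : Shared T Val)
    (γ' : Ghost T Val) : Prop where
  top : g'.top = g.top
  loc : ∀ u ≠ t, g'.location u = g.location u
  owns : ∀ o ≠ some t, ∀ a d, Owns g γ o a d → Owns g' γ' o a d

theorem Frame.refl (t : T) (g : Shared T Val) (γ : Ghost T Val) : Frame t g γ g γ :=
  ⟨rfl, fun _ _ => rfl, fun _ _ _ _ h => h⟩

theorem Frame.modifyNode {t : T} {g : Shared T Val} {γ : Ghost T Val} {a : ℕ} {d : Node Val}
    (h : Owns g γ (some t) a d) (f : Node Val → Node Val) :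
    Frame t g γ (g.modifyNode (some a) f) γ := by
  refine ⟨rfl, fun _ _ => rfl, ?_⟩
  rintro o ho a' d' ⟨h₁, h₂⟩
  refine ⟨h₁, ?_⟩
  have : a' ≠ a := by rintro rfl; exact ho (h₁.symm.trans h.1)
  simp [Shared.modifyNode, this, h₂]

theorem Owns.modifyNode {o : Option T} {g : Shared T Val} {γ : Ghost T Val} {a : ℕ} {d : Node Val}
    (h : Owns g γ o a d) (f : Node Val → Node Val) :
    Owns (g.modifyNode (some a) f) γ o a (f d) :=
  ⟨h.1, by simp [Shared.modifyNode, h.2]⟩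

/-- The absence of address reuse enters here: the new address held no node, so it is none of those
that any thread relies on. -/
theorem Frame.malloc (t : T) {g : Shared T Val} (γ : Ghost T Val) {a : ℕ} (h : g.heap a = none)
    (d : Node Val) :
    Frame t g γ { g with heap := Function.update g.heap a (some d) }
      { γ with owner := Function.update γ.owner a (some t) } := by
  refine ⟨rfl, fun _ _ => rfl, ?_⟩
  rintro o ho a' d' ⟨h₁, h₂⟩
  have : a' ≠ a := by rintro rfl; simp [h] at h₂
  simp [Owns, this, h₁, h₂]

variable [DecidableEq T] {empty : Val}

/-! ### Steps of a single thread -/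

/-- The step is a successful CAS on `top` or a successful second CAS. -/
def LinLabel (ℓ : Label (elimStack T empty)) : Prop :=
  ℓ = Label.arw (.prim STest.topEqOld) SAct.topToN ∨
  ℓ = Label.arw (.prim STest.topEqOld) SAct.topToNew ∨
  ℓ = Label.arw (.prim STest.himEqQ) SAct.setHim

/-- A step that linearizes nothing. -/
def SilentStep (t : T) (g : Shared T Val) (γ : Ghost T Val) (ℓ : Label (elimStack T empty))
    (l' : Locals T Val) (g' : Shared T Val) (pc' : Option PC) : Prop :=
  ¬ LinLabel ℓ ∧ (∀ r : Option Val, ℓ = Label.ret (O := elimStack T empty) r → γ.res t = some r) ∧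
  ∃ ow, Frame t g γ g' { γ with owner := ow } ∧ PostInv empty t l' g' { γ with owner := ow } pc'

theorem SInstr.Exec.locals {i : SInstr} {l l' : Locals T Val} {g g' : Shared T Val}
    {ℓ : Label (elimStack T empty)} (h : SInstr.Exec empty i l g ℓ l' g') :
    l'.mytid = l.mytid ∧ l'.p = l.p := by
  have aux : ∀ a, sActSem a l g l' g' → l'.mytid = l.mytid ∧ l'.p = l.p := by
    intro a ha
    cases a <;> simp only [sActSem] at ha <;> grind
  cases i with
  | act a => exact aux a h.2
  | test b => obtain ⟨-, -, rfl, -⟩ := h; exact ⟨rfl, rfl⟩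
  | arw b a => exact aux a h.2.2
  | ret e => obtain ⟨-, rfl, -⟩ := h; exact ⟨rfl, rfl⟩

theorem not_linLabel_act (a : SAct) : ¬ LinLabel (T := T) (empty := empty) (Label.act a) := by
  rintro (h | h | h) <;> cases h

theorem not_linLabel_test (b : BExp STest) :
    ¬ LinLabel (T := T) (empty := empty) (Label.test b) := by
  rintro (h | h | h) <;> cases h

theorem not_linLabel_ret (r : Option Val) :
    ¬ LinLabel (T := T) (empty := empty) (Label.ret (O := elimStack T empty) r) := by
  rintro (h | h | h) <;> cases h

theorem Frame.location (t : T) (g : Shared T Val) (γ : Ghost T Val) (x : Option (Desc T Val)) :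
    Frame t g γ { g with location := Function.update g.location t x } γ :=
  ⟨rfl, fun _ hu => Function.update_of_ne hu _ _, fun _ _ _ _ h => h⟩

theorem SilentStep.act {t : T} {g g' : Shared T Val} {γ : Ghost T Val} {a : SAct}
    {l' : Locals T Val} {pc' : Option PC} (hf : Frame t g γ g' γ)
    (hp : PostInv empty t l' g' γ pc') :
    SilentStep t g γ (Label.act a : Label (elimStack T empty)) l' g' pc' :=
  ⟨not_linLabel_act a, fun _ h => (by cases h), γ.owner, hf, hp⟩

theorem SilentStep.arw {t : T} {g g' : Shared T Val} {γ : Ghost T Val} {b : BExp STest} {a : SAct}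
    {l' : Locals T Val} {pc' : Option PC}
    (ha : a ≠ .topToN ∧ a ≠ .topToNew ∧ a ≠ .setHim) (hf : Frame t g γ g' γ)
    (hp : PostInv empty t l' g' γ pc') :
    SilentStep t g γ (Label.arw b a : Label (elimStack T empty)) l' g' pc' := by
  refine ⟨?_, fun _ h => (by cases h), γ.owner, hf, hp⟩
  rintro (h | h | h) <;> cases h <;> simp at ha

theorem SilentStep.test {t : T} {g : Shared T Val} {γ : Ghost T Val} {b : BExp STest}
    {l : Locals T Val} {pc' : Option PC} (hp : PostInv empty t l g γ pc') :
    SilentStep t g γ (Label.test b : Label (elimStack T empty)) l g pc' :=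
  ⟨not_linLabel_test b, fun _ h => (by cases h), γ.owner, Frame.refl _ _ _, hp⟩

theorem SilentStep.ret {t : T} {g : Shared T Val} {γ : Ghost T Val} {r : Option Val}
    {l : Locals T Val} (hg : g.location t = none) (hr : γ.res t = some r) :
    SilentStep t g γ (Label.ret (O := elimStack T empty) r) l g none :=
  ⟨not_linLabel_ret r, fun _ h => (by cases h; exact hr), γ.owner, Frame.refl _ _ _, hg, r, hr⟩

/-- The first step of an iteration, common to `start` and `restart`: an allocation for a push, a
read of `top` for a pop. Only the read of NULL linearizes. -/
theorem Unlin.step_cases {t : T} {l l' : Locals T Val} {g g' : Shared T Val} {γ : Ghost T Val}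
    {i : SInstr} {pc' : Option PC} {ℓ : Label (elimStack T empty)} (h : Unlin t g γ)
    (htop : ∀ a, g.top = some a → ∃ d, Owns g γ none a d)
    (hi : (i, pc') ∈ PC.start.next l.p.op) (he : SInstr.Exec empty i l g ℓ l' g') :
    SilentStep t g γ ℓ l' g' pc' ∨
    (Unlin t g γ ∧ l.p.op = .pop ∧ g.top = none ∧ i = .act .readTop ∧
      pc' = some PC.popReadTop) := by
  cases hop : l.p.op <;> simp only [hop, PC.next, List.mem_singleton, Prod.mk.injEq] at hi <;>
    obtain ⟨rfl, rfl⟩ := hi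
  · obtain ⟨rfl, a, d, ha, rfl, rfl⟩ := he
    refine Or.inl ⟨not_linLabel_act _, fun _ h => (by cases h), _, Frame.malloc t γ ha d, h, hop,
      a, d, rfl, ?_⟩
    simp [Owns]
  · cases hg : g.top with
    | none => exact Or.inr ⟨h, rfl, rfl, rfl, rfl⟩
    | some a =>
      obtain ⟨rfl, rfl, rfl⟩ := he
      obtain ⟨d, hd⟩ := htop a hg
      exact Or.inl (.act (Frame.refl _ _ _) ⟨h.2, hop, Or.inr ⟨h.1, a, d, hg, hd⟩⟩)

/-- A step either linearizes nothing, or is one of the four kinds of linearization points. -/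
theorem PC.Inv.step_cases {t : T} {l l' : Locals T Val} {g g' : Shared T Val} {γ : Ghost T Val}
    {pc : PC} {i : SInstr} {pc' : Option PC} {ℓ : Label (elimStack T empty)}
    (h : pc.Inv empty t l g γ) (ht : l.mytid = t) (hid : l.p.id = t)
    (htop : ∀ a, g.top = some a → ∃ d, Owns g γ none a d)
    (hi : (i, pc') ∈ pc.next l.p.op) (he : SInstr.Exec empty i l g ℓ l' g') :
    SilentStep t g γ ℓ l' g' pc' ∨
    (pc = pushSetNext ∧ i = .arw (.prim .topEqOld) .topToN ∧ pc' = some pushCAS) ∨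
    (pc = popReadNext ∧ i = .arw (.prim .topEqOld) .topToNew ∧ pc' = some popCAS) ∨
    (Unlin t g γ ∧ l.p.op = .pop ∧ g.top = none ∧ i = .act .readTop ∧ pc' = some popReadTop) ∨
    (pc = firstCAS ∧ i = .arw (.prim .himEqQ) .setHim ∧ pc' = some secondCAS) := by
  subst ht
  -- `hcoll` and `hmine` are the two outcomes of the CAS that withdraws the descriptor. If it fails,
  -- a partner has overwritten the cell; if it succeeds, there was none, because after a collision
  -- the cell does not hold a descriptor with the thread's own id.
  have hcoll : Awaiting l.mytid l g γ → ¬ g.location l.mytid = some l.p →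
      Collided l.mytid l g γ := by
    rintro (h | h) hne
    · exact absurd h.2 hne
    · exact h
  have hmine : Awaiting l.mytid l g γ → g.location l.mytid = some l.p → γ.res l.mytid = none := by
    rintro (h | h) he
    · exact h.1
    · exact absurd hid (h.2 _ he)
  cases pc
  case start => exact (Unlin.step_cases h htop hi he).imp id fun h => Or.inr (Or.inr (Or.inl h))
  case restart => exact (Unlin.step_cases h htop hi he).imp id fun h => Or.inr (Or.inr (Or.inl h))
  all_goals
    simp only [PC.next, List.mem_cons, List.not_mem_nil, or_false, Prod.mk.injEq] at hi
    first
    | obtain ⟨rfl, rfl⟩ : _ ∧ _ := hi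
    | obtain ⟨rfl, rfl⟩ | ⟨rfl, rfl⟩ := hi
  all_goals first
    | exact Or.inr (Or.inl ⟨rfl, rfl, rfl⟩)
    | exact Or.inr (Or.inr (Or.inl ⟨rfl, rfl, rfl⟩))
    | exact Or.inr (Or.inr (Or.inr (Or.inr ⟨rfl, rfl, rfl⟩)))
    | refine Or.inl ?_
  case pushMalloc =>
    obtain ⟨rfl, rfl, rfl⟩ := he
    obtain ⟨hu, hop, a, d, hn, ho⟩ := h
    rw [hn]
    exact .act (Frame.modifyNode ho _) ⟨hu, hop, a, _, hn, ho.modifyNode _, rfl⟩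
  case pushSetVal =>
    obtain ⟨rfl, rfl, rfl⟩ := he
    exact .act (Frame.refl _ _ _) h
  case pushReadTop =>
    obtain ⟨rfl, rfl, rfl⟩ := he
    obtain ⟨hu, hop, a, d, hn, ho, hv⟩ := h
    rw [hn]
    exact .act (Frame.modifyNode ho _) ⟨hu, hop, a, _, hn, ho.modifyNode _, hv, rfl⟩
  case pushSetNext =>
    obtain ⟨rfl, -, rfl, rfl⟩ := he
    exact .test h.1
  case pushCAS =>
    obtain ⟨rfl, rfl, rfl⟩ := he
    exact .ret h.1 h.2
  case popReadTop.inl =>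
    obtain ⟨rfl, hb, rfl, rfl⟩ := he
    obtain ⟨hl, hop, h | ⟨-, a, d, ha, -⟩⟩ := h
    · exact .test ⟨hl, h.2⟩
    · exact absurd (ha.symm.trans hb) (by simp)
  case popReadTop.inr =>
    obtain ⟨rfl, hb, rfl, rfl⟩ := he
    obtain ⟨hl, hop, h | ⟨hr, h⟩⟩ := h
    · exact absurd h.1 hb
    · exact .test ⟨⟨hr, hl⟩, hop, h⟩
  case popNull =>
    obtain ⟨rfl, rfl, rfl⟩ := he
    exact .ret h.1 h.2
  case popNonNull =>
    obtain ⟨rfl, rfl, rfl⟩ := he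
    obtain ⟨hu, hop, a, d, ha, ho⟩ := h
    exact .act (Frame.refl _ _ _) ⟨hu, hop, a, d, ha, ho, by simp [Shared.deref, ha, ho.2]⟩
  case popReadNext =>
    obtain ⟨rfl, -, rfl, rfl⟩ := he
    exact .test h.1
  case popCAS =>
    obtain ⟨rfl, rfl, rfl⟩ := he
    obtain ⟨hl, a, d, ha, ho, hr⟩ := h
    -- The node is public, hence unchanged since the CAS, and still holds the promised value.
    exact .act (Frame.refl _ _ _) ⟨hl, by simp [Shared.deref, ha, ho.2, hr]⟩
  case popReadVal =>
    obtain ⟨rfl, rfl, rfl⟩ := he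
    exact .ret h.1 h.2
  case failed =>
    obtain ⟨rfl, rfl, rfl⟩ := he
    exact .act (Frame.location _ _ _ _) (Or.inl ⟨h.1, by simp⟩)
  case published =>
    obtain ⟨rfl, ⟨j, rfl⟩, rfl⟩ := he
    exact .act (Frame.refl _ _ _) h
  case chosen =>
    obtain ⟨rfl, rfl, rfl⟩ := he
    exact .act (Frame.refl _ _ _) h
  case collisionChanged =>
    obtain ⟨rfl, rfl, rfl⟩ := he
    exact .act (Frame.refl _ _ _) h
  case collisionRead.inl =>
    obtain ⟨rfl, -, rfl, rfl⟩ := he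
    exact .test h
  case collisionReread.inl =>
    obtain ⟨rfl, -, rfl, rfl⟩ := he
    exact .test h
  case collisionRead.inr =>
    obtain ⟨rfl, -, rfl, rfl⟩ := he
    -- The `collision` array is merely a hint for finding partners; no assertion depends on its
    -- contents.
    exact .arw (by simp) ⟨rfl, fun _ _ => rfl, fun _ _ _ _ h => h⟩ h
  case collisionReread.inr =>
    obtain ⟨rfl, -, rfl, rfl⟩ := he
    exact .arw (by simp) ⟨rfl, fun _ _ => rfl, fun _ _ _ _ h => h⟩ h
  case announced.inl =>
    obtain ⟨rfl, -, rfl, rfl⟩ := he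
    exact .test h
  case announced.inr =>
    obtain ⟨rfl, -, rfl, rfl⟩ := he
    exact .test h
  case himFound =>
    obtain ⟨rfl, rfl, rfl⟩ := he
    exact .act (Frame.refl _ _ _) h
  case himRead.inl =>
    obtain ⟨rfl, ⟨-, ⟨d, hd, hh⟩, ⟨d', hd', hop⟩⟩, rfl, rfl⟩ := he
    obtain rfl : d = d' := Option.some.inj (hd.symm.trans hd')
    exact .test ⟨h, d, hd, hh, hop⟩
  case himRead.inr =>
    obtain ⟨rfl, -, rfl, rfl⟩ := he
    exact .test h
  case colliding.inl =>
    obtain ⟨rfl, hb, rfl, rfl⟩ := he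
    exact .arw (by simp) (Frame.location _ _ _ _) ⟨⟨hmine h.1 hb, by simp⟩, h.2⟩
  case colliding.inr =>
    obtain ⟨rfl, hb, rfl, rfl⟩ := he
    exact .test (hcoll h.1 hb)
  case clearing.inl =>
    obtain ⟨rfl, hb, rfl, rfl⟩ := he
    exact .arw (by simp) (Frame.location _ _ _ _) ⟨hmine h hb, by simp⟩
  case clearing.inr =>
    obtain ⟨rfl, hb, rfl, rfl⟩ := he
    exact .test (hcoll h hb)
  case firstCAS =>
    obtain ⟨rfl, -, rfl, rfl⟩ := he
    exact .test h.1
  case secondCAS =>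
    obtain ⟨rfl, rfl, rfl⟩ := he
    exact .ret h.1 h.2
  case finishing =>
    obtain ⟨rfl, rfl, rfl⟩ := he
    exact .act (Frame.refl _ _ _) h
  case mineRead =>
    obtain ⟨rfl, rfl, rfl⟩ := he
    exact .act (Frame.location _ _ _ _) ⟨by simp, h.1⟩
  case mineCleared =>
    obtain ⟨rfl, rfl, rfl⟩ := he
    exact .ret h.1 h.2

end ThreadInvariant

/-! ### Invariant of the configurations -/

section ConfigInvariant

variable {T : Type u} {Val : Type v}

/-- The list of nodes starting at a pointer is public and holds the given values. -/
inductive Chain (g : Shared T Val) (γ : Ghost T Val) : Option ℕ → List Val → Prop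
  | nil : Chain g γ none []
  | cons {a d v s} (ho : Owns g γ none a d) (hv : d.val = some v) (hs : Chain g γ d.next s) :
      Chain g γ (some a) (v :: s)

theorem Chain.mono {g g' : Shared T Val} {γ γ' : Ghost T Val} {x : Option ℕ} {s : List Val}
    (h : Chain g γ x s) (hpub : ∀ a d, Owns g γ none a d → Owns g' γ' none a d) :
    Chain g' γ' x s := by
  induction h with
  | nil => exact .nil
  | cons ho hv _ ih => exact .cons (hpub _ _ ho) hv ih

theorem Chain.owns {g : Shared T Val} {γ : Ghost T Val} {a : ℕ} {s : List Val}
    (h : Chain g γ (some a) s) : ∃ d, Owns g γ none a d := by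
  cases h with
  | cons ho _ _ => exact ⟨_, ho⟩

theorem forall₂_imp_of_mem {α β : Type*} {R S : α → β → Prop} {l : List α} {m : List β}
    (h : List.Forall₂ R l m) (hRS : ∀ a ∈ l, ∀ b, R a b → S a b) : List.Forall₂ S l m := by
  induction h with
  | nil => exact .nil
  | cons hab _ ih =>
    exact .cons (hRS _ (by simp) _ hab) (ih fun a ha => hRS a (by simp [ha]))

/-- What a silent step of `t` guarantees is what every other thread relies on. -/
theorem Frame.sameFor {t u : T} {g g' : Shared T Val} {γ : Ghost T Val} {ow : ℕ → Option T}
    (h : Frame t g γ g' { γ with owner := ow }) (hu : u ≠ t) :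
    SameFor u g γ g' { γ with owner := ow } :=
  ⟨rfl, h.loc u hu, h.owns none (by simp), h.owns (some u) (by simpa using hu)⟩

variable [DecidableEq T] {empty : Val} {env : Env (elimStack T empty)}

/-- The thread `t` is to invoke `push(x)`. -/
def EnvPush (env : Env (elimStack T empty)) (t : T) (x : Val) : Prop :=
  env t = some ⟨StackMeth.push, x⟩

/-- The thread `t` is to invoke `pop()`. -/
def EnvPop (env : Env (elimStack T empty)) (t : T) : Prop :=
  env t = some ⟨StackMeth.pop, PUnit.unit⟩

/-- The constant local variables of a thread are those given by its invocation. -/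
structure Invocation (env : Env (elimStack T empty)) (t : T) (l : Locals T Val) : Prop where
  mytid : l.mytid = t
  id : l.p.id = t
  op : (l.p.op = .push ∧ ∃ x, EnvPush env t x ∧ l.p.input = some x) ∨
    (l.p.op = .pop ∧ EnvPop env t)

/-- The invariant of a thread. -/
def ThreadInv (env : Env (elimStack T empty)) (t : T) (g : Shared T Val) (γ : Ghost T Val) :
    Option (Locals T Val × Option SCode) → Prop
  | none => Unlin t g γ
  | some (_, none) => Returned t g γ
  | some (l, some k) => Invocation env t l ∧ ∃ pc : PC, k = pc.code l.p.op ∧ pc.Inv empty t l g γ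

theorem ThreadInv.mono {t : T} {g g' : Shared T Val} {γ γ' : Ghost T Val}
    {x : Option (Locals T Val × Option SCode)} (h : ThreadInv env t g γ x)
    (hs : SameFor t g γ g' γ') : ThreadInv env t g' γ' x := by
  rcases x with _ | ⟨l, _ | k⟩
  · simpa only [ThreadInv, Unlin, hs.res, hs.loc] using h
  · simpa only [ThreadInv, Returned, hs.res, hs.loc] using h
  · obtain ⟨hi, pc, hk, hpc⟩ := h
    exact ⟨hi, pc, hk, hpc.mono hs⟩

theorem ThreadInv.of_postInv {t : T} {l : Locals T Val} {g : Shared T Val} {γ : Ghost T Val}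
    {pc : Option PC} {m : StackMeth} (hi : Invocation env t l) (hm : l.p.op = m)
    (h : PostInv empty t l g γ pc) : ThreadInv env t g γ (some (l, pc.map (PC.code m))) := by
  subst hm
  cases pc with
  | none => exact h
  | some pc => exact ⟨hi, pc, rfl, h⟩

/-- The operation `o` is the one `t` is to invoke, with the return value `t` is bound to produce. -/
def OpOf (env : Env (elimStack T empty)) (γ : Ghost T Val) (t : T) (o : StackOp Val) : Prop :=
  env t = some ⟨o.meth, o.arg⟩ ∧ γ.res t = some o.ret

/-- The invariant of a configuration. -/
structure ConfInv (env : Env (elimStack T empty)) (C : Config (elimStack T empty))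
    (γ : Ghost T Val) : Prop where
  thr : ∀ t, ThreadInv env t C.gl γ (C.thr t)
  nodup : γ.ts.Nodup
  mem_iff : ∀ t, t ∈ γ.ts ↔ γ.res t ≠ none
  stack : ∃ s os, Chain C.gl γ (Shared.top C.gl) s ∧ List.Forall₂ (OpOf env γ) γ.ts os ∧
    -- This says in continuation form that `os` leads from the empty stack to `s`, so that runs
    -- compose without a function computing the final stack.
    ∀ os', StackRun empty s os' → StackRun empty [] (os ++ os')

theorem ConfInv.init :
    ConfInv env (Config.init (elimStack T empty)) ⟨[], fun _ => none, fun _ => none⟩ where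
  thr _ := ⟨rfl, rfl⟩
  nodup := List.nodup_nil
  mem_iff := by simp
  stack := ⟨[], [], .nil, .nil, fun _ h => h⟩

/-- The bookkeeping common to all steps: operations already linearized keep their promised results,
so only the run of the new operations from the current stack has to be supplied. -/
theorem ConfInv.extend {C C' : Config (elimStack T empty)} {γ γ' : Ghost T Val} {new : List T}
    (h : ConfInv env C γ) (hthr : ∀ t, ThreadInv env t C'.gl γ' (C'.thr t))
    (hts : γ'.ts = γ.ts ++ new) (hnd : new.Nodup)
    (hnew : ∀ t ∈ new, γ.res t = none ∧ γ'.res t ≠ none)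
    (hres : ∀ t, t ∉ new → γ'.res t = γ.res t)
    (hstack : ∀ s, Chain C.gl γ (Shared.top C.gl) s → ∃ s' os,
      Chain C'.gl γ' (Shared.top C'.gl) s' ∧
      List.Forall₂ (OpOf env γ') new os ∧
      ∀ os', StackRun empty s' os' → StackRun empty s (os ++ os')) :
    ConfInv env C' γ' where
  thr := hthr
  nodup := by
    rw [hts, List.nodup_append]
    refine ⟨h.nodup, hnd, ?_⟩
    rintro a ha b hb rfl
    exact (h.mem_iff a).1 ha (hnew a hb).1
  mem_iff t := by
    rw [hts, List.mem_append, h.mem_iff]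
    by_cases ht : t ∈ new
    · simp [ht, (hnew t ht).2]
    · simp [ht, hres t ht]
  stack := by
    obtain ⟨s, os, hc, hos, hrun⟩ := h.stack
    obtain ⟨s', os₁, hc', hos₁, hrun'⟩ := hstack s hc
    refine ⟨s', os ++ os₁, hc', ?_, fun os' hos' => ?_⟩
    · rw [hts]
      refine List.rel_append (forall₂_imp_of_mem hos fun t ht o ho => ⟨ho.1, ?_⟩) hos₁
      rw [hres t fun hn => (h.mem_iff t).1 ht (hnew t hn).1]
      exact ho.2
    · have hrun₁ := hrun' _ hos'
      rw [List.append_assoc]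
      exact hrun _ hrun₁

/-! ### Effect of a step on the auxiliary state -/

/-- The threads linearized by a step of `t` with label `ℓ`. -/
inductive Linearizes (env : Env (elimStack T empty)) (C : Config (elimStack T empty))
    (γ' : Ghost T Val) (t : T) (ℓ : Label (elimStack T empty)) : List T → Prop
  | silent (h : ¬ LinLabel ℓ) : Linearizes env C γ' t ℓ []
  | topCAS (h : ℓ = Label.arw (.prim STest.topEqOld) SAct.topToN ∨
      ℓ = Label.arw (.prim STest.topEqOld) SAct.topToNew) : Linearizes env C γ' t ℓ [t]
  | emptyRead (h : ℓ = Label.act SAct.readTop) (htop : Shared.top C.gl = none) (henv : EnvPop env t)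
      (hres : γ'.res t = some (some empty)) : Linearizes env C γ' t ℓ [t]
  | collision (h : ℓ = Label.arw (.prim STest.himEqQ) SAct.setHim) {l : Locals T Val}
      {c : Option SCode} (hl : C.thr t = some (l, c)) {b s₁ s₂ : T} {x : Val}
      (hhim : l.him = some b) (hs : s₁ = t ∧ s₂ = b ∨ s₁ = b ∧ s₂ = t)
      (h₁ : EnvPush env s₁ x) (h₂ : EnvPop env s₂) : Linearizes env C γ' t ℓ [s₁, s₂]

/-- The change of the auxiliary state by a step of `t` with label `ℓ`. -/
structure GhostStep (env : Env (elimStack T empty)) (C : Config (elimStack T empty))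
    (γ γ' : Ghost T Val) (t : T) (ℓ : Label (elimStack T empty)) (new : List T) : Prop where
  ts : γ'.ts = γ.ts ++ new
  res : ∀ u, u ∉ new → γ'.res u = γ.res u
  invoked : ∀ u ∈ new, C.thr u ≠ none
  kind : Linearizes env C γ' t ℓ new
  ret : ∀ r : Option Val, ℓ = Label.ret (O := elimStack T empty) r → γ.res t = some r

theorem Invocation.mono {t : T} {l l' : Locals T Val} (h : Invocation env t l)
    (hl : l'.mytid = l.mytid ∧ l'.p = l.p) : Invocation env t l' :=
  ⟨hl.1.trans h.mytid, hl.2 ▸ h.id, hl.2 ▸ h.op⟩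

theorem Invocation.push {t : T} {l : Locals T Val} (h : Invocation env t l)
    (hop : l.p.op = .push) : ∃ x, EnvPush env t x ∧ l.p.input = some x := by
  rcases h.op with h | h
  · exact h.2
  · simp [hop] at h

theorem Invocation.pop {t : T} {l : Locals T Val} (h : Invocation env t l)
    (hop : l.p.op = .pop) : EnvPop env t := by
  rcases h.op with h | h
  · simp [hop] at h
  · exact h.2

/-- The outcome of a step of `t` that leads to a given configuration. -/
def StepOutcome (env : Env (elimStack T empty)) (C : Config (elimStack T empty)) (γ : Ghost T Val)
    (t : T) (ℓ : Label (elimStack T empty)) (C' : Config (elimStack T empty)) : Prop :=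
  ∃ γ' new, ConfInv env C' γ' ∧ GhostStep env C γ γ' t ℓ new

/-- The configuration after a step of `t`. -/
def Config.set (C : Config (elimStack T empty)) (t : T) (g : Shared T Val)
    (x : Locals T Val × Option SCode) : Config (elimStack T empty) :=
  ⟨g, Function.update C.thr t (some x)⟩

theorem Config.forall_set {C : Config (elimStack T empty)} {t : T} {g : Shared T Val}
    {x : Locals T Val × Option SCode} {P : T → Option (Locals T Val × Option SCode) → Prop}
    (ht : P t (some x)) (hu : ∀ u ≠ t, P u (C.thr u)) : ∀ u, P u ((C.set t g x).thr u) := by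
  intro u
  by_cases h : u = t
  · subst h
    have hx : (C.set u g x).thr u = some x := Function.update_self ..
    exact hx ▸ ht
  · have hx : (C.set t g x).thr u = C.thr u := Function.update_of_ne h ..
    exact hx ▸ hu u h

end ConfigInvariant

/-! ### Preservation of the invariant -/

section Preservation

variable {T : Type u} {Val : Type v} [DecidableEq T] {empty : Val}
  {env : Env (elimStack T empty)} {C : Config (elimStack T empty)} {γ : Ghost T Val} {t : T}
  {ℓ : Label (elimStack T empty)} {l l' : Locals T Val} {c : Option SCode} {m : StackMeth}

theorem ConfInv.silent {g' : Shared T Val} {pc' : Option PC} (h : ConfInv env C γ)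
    (hi : Invocation env t l') (hm : l'.p.op = m)
    (hs : SilentStep t C.gl γ ℓ l' g' pc') :
    StepOutcome env C γ t ℓ (C.set t g' (l', pc'.map (PC.code m))) := by
  obtain ⟨hℓ, hret, ow, hf, hp⟩ := hs
  refine ⟨{ γ with owner := ow }, [], h.extend (new := []) ?_ (by simp) (by simp) (by simp)
    (fun _ _ => rfl) ?_, ⟨by simp, fun _ _ => rfl, by simp, .silent hℓ, hret⟩⟩
  · exact Config.forall_set (P := fun u x => ThreadInv env u g' { γ with owner := ow } x)
      (.of_postInv hi hm hp) fun u hu => (h.thr u).mono (hf.sameFor hu)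
  · intro s hs
    refine ⟨s, [], ?_, .nil, fun _ h => h⟩
    change Chain g' _ g'.top s
    rw [hf.top]
    exact hs.mono (hf.owns none (by simp))

theorem ConfInv.inv {x : StackArg Val m} (h : ConfInv env C γ) (he : env t = some ⟨m, x⟩)
    (ht : C.thr t = none) :
    StepOutcome env C γ t (Label.inv (O := elimStack T empty) m x)
      (C.set t C.gl ((elimStack T empty).initLo t m x, some (loopCode m))) := by
  have hu : Unlin t C.gl γ := by
    have := h.thr t
    rw [ht] at this
    exact this
  refine ⟨γ, [], h.extend (new := []) ?_ (by simp) (by simp) (by simp) (fun _ _ => rfl) ?_,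
    ⟨by simp, fun _ _ => rfl, by simp, .silent ?_, fun r hr => by cases hr⟩⟩
  · refine Config.forall_set (P := fun u x => ThreadInv env u C.gl γ x) ?_ fun u _ => h.thr u
    refine ⟨⟨rfl, rfl, ?_⟩, .start, ?_, hu⟩
    · cases m
      · exact Or.inl ⟨rfl, x, he, rfl⟩
      · exact Or.inr ⟨rfl, he⟩
    · cases m <;> rfl
  · exact fun s hs => ⟨s, [], hs, .nil, fun _ h => h⟩
  · rintro (h | h | h) <;> cases h

/-- The node of `t` becomes public by losing its owner, on which only `t` relied. Its `next` field
is `oldTop`, which the CAS has just found equal to `top`, so the chain grows by one node. -/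
theorem ConfInv.pushCAS (h : ConfInv env C γ) (hl : C.thr t = some (l, c))
    (hi : Invocation env t l) (hpc : PC.pushSetNext.Inv empty t l C.gl γ)
    (htop : Shared.top C.gl = l.oldTop) :
    StepOutcome env C γ t (Label.arw (.prim STest.topEqOld) SAct.topToN)
      (C.set t { C.gl with top := l.n } (l, some (PC.pushCAS.code l.p.op))) := by
  obtain ⟨hu, hop, a, d, hn, ho, hv, hd⟩ := hpc
  obtain ⟨x, hx, hin⟩ := hi.push hop
  have hown : ∀ o ≠ some t, ∀ a' d', Owns C.gl γ o a' d' →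
      Owns { C.gl with top := l.n }
        ⟨γ.ts ++ [t], Function.update γ.res t (some none), Function.update γ.owner a none⟩
        o a' d' := by
    rintro o hne a' d' ⟨h₁, h₂⟩
    have : a' ≠ a := by rintro rfl; exact hne (h₁.symm.trans ho.1)
    exact ⟨by simp [this, h₁], h₂⟩
  refine ⟨⟨γ.ts ++ [t], Function.update γ.res t (some none), Function.update γ.owner a none⟩, [t],
    h.extend ?_ rfl (by simp) ?_ ?_ ?_, ⟨rfl, ?_, by simp [hl], .topCAS (Or.inl rfl), ?_⟩⟩
  · refine Config.forall_set (P := fun u x => ThreadInv env u _ _ x)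
      ⟨hi, .pushCAS, rfl, hu.2, by simp⟩ fun u hut => (h.thr u).mono ?_
    exact ⟨by simp [hut], rfl, hown none (by simp), hown (some u) (by simpa using hut)⟩
  · simp [hu.1]
  · intro u hut
    simp_all
  · intro s hs
    refine ⟨x :: s, [⟨.push, x, none⟩], ?_, .cons ⟨hx, by simp⟩ .nil, fun os' h' => ⟨rfl, h'⟩⟩
    change Chain _ _ l.n _
    rw [hn]
    refine .cons (d := d) ⟨by simp, ho.2⟩ (hv.trans hin) ?_
    rw [hd, ← htop]
    rw [← hn]
    exact hs.mono (hown none (by simp))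
  · intro u hut
    simp_all
  · intro r hr
    cases hr

/-- The popped node stays public, so other threads that still hold it in `oldTop` keep their
assertions. -/
theorem ConfInv.popCAS (h : ConfInv env C γ) (hl : C.thr t = some (l, c))
    (hi : Invocation env t l) (hpc : PC.popReadNext.Inv empty t l C.gl γ)
    (htop : Shared.top C.gl = l.oldTop) :
    StepOutcome env C γ t (Label.arw (.prim STest.topEqOld) SAct.topToNew)
      (C.set t { C.gl with top := l.newTop } (l, some (PC.popCAS.code l.p.op))) := by
  obtain ⟨hu, hop, a, d, ha, ho, hd⟩ := hpc
  have hx := hi.pop hop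
  refine ⟨⟨γ.ts ++ [t], Function.update γ.res t (some d.val), γ.owner⟩, [t],
    h.extend ?_ rfl (by simp) ?_ ?_ ?_, ⟨rfl, ?_, by simp [hl], .topCAS (Or.inr rfl), ?_⟩⟩
  · refine Config.forall_set (P := fun u x => ThreadInv env u _ _ x)
      ⟨hi, .popCAS, rfl, hu.2, a, d, ha, ho, by simp⟩ fun u hut => (h.thr u).mono ?_
    exact ⟨by simp [hut], rfl, fun _ _ h => h, fun _ _ h => h⟩
  · simp [hu.1]
  · intro u hut
    simp_all
  · intro s hs
    rw [htop, ha] at hs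
    cases hs with
    | @cons _ d' v s ho' hv hs =>
      -- No ABA problem: the node inspected earlier and the head of the chain have the same address
      -- in the present heap, so `newTop` is the rest of the chain.
      obtain rfl : d = d' := Option.some.inj (ho.2.symm.trans ho'.2)
      refine ⟨s, [⟨.pop, PUnit.unit, some v⟩], ?_, .cons ⟨hx, by simp [hv]⟩ .nil,
        fun os' h' => ⟨rfl, h'⟩⟩
      change Chain _ _ l.newTop _
      rw [hd]
      exact hs.mono fun _ _ h => h
  · intro u hut
    simp_all
  · intro r hr
    cases hr

/-- The pop must be linearized at the read, since `top` may have changed when `oldTop` is tested. -/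
theorem ConfInv.emptyRead (h : ConfInv env C γ) (hl : C.thr t = some (l, c))
    (hi : Invocation env t l) (hu : Unlin t C.gl γ) (hop : l.p.op = .pop)
    (htop : Shared.top C.gl = none) :
    StepOutcome env C γ t (Label.act SAct.readTop)
      (C.set t C.gl ({ l with oldTop := Shared.top C.gl }, some (PC.popReadTop.code l.p.op))) := by
  have hx := hi.pop hop
  refine ⟨⟨γ.ts ++ [t], Function.update γ.res t (some (some empty)), γ.owner⟩, [t],
    h.extend ?_ rfl (by simp) ?_ ?_ ?_,
    ⟨rfl, ?_, by simp [hl], .emptyRead rfl htop hx (by simp), ?_⟩⟩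
  · refine Config.forall_set (P := fun u x => ThreadInv env u _ _ x)
      ⟨hi.mono ⟨rfl, rfl⟩, .popReadTop, rfl, hu.2, hop, Or.inl ⟨htop, by simp⟩⟩
      fun u hut => (h.thr u).mono ?_
    exact ⟨by simp [hut], rfl, fun _ _ h => h, fun _ _ h => h⟩
  · simp [hu.1]
  · intro u hut
    simp_all
  · intro s hs
    rw [htop] at hs
    cases hs
    refine ⟨[], [⟨.pop, PUnit.unit, some empty⟩], ?_, .cons ⟨hx, by simp⟩ .nil,
      fun os' h' => ⟨rfl, h'⟩⟩
    change Chain _ _ (Shared.top C.gl) _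
    rw [htop]
    exact .nil
  · intro u hut
    simp_all
  · intro r hr
    cases hr

/-- The shared state after an assignment to `location[b]`. -/
def Shared.setLocation (g : Shared T Val) (b : T) (x : Option (Desc T Val)) : Shared T Val :=
  { g with location := Function.update g.location b x }

/-- A thread whose own descriptor is in its `location` cell is running and waits for a partner. -/
theorem ThreadInv.awaiting {g : Shared T Val} {b : T} {x : Option (Locals T Val × Option SCode)}
    (h : ThreadInv env b g γ x) {d : Desc T Val} (hd : g.location b = some d) (hid : d.id = b) :
    ∃ lb, x ≠ none ∧ Invocation env b lb ∧ d = lb.p ∧ γ.res b = none ∧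
      ∀ g' γ', Collided b lb g' γ' → ThreadInv env b g' γ' x := by
  rcases x with _ | ⟨lb, _ | k⟩
  · simp [ThreadInv, Unlin, hd] at h
  · simp [ThreadInv, Returned, hd] at h
  · obtain ⟨hi, pc, hk, hpc⟩ := h
    obtain ⟨hr, hp, hc⟩ := hpc.awaiting hd hid
    exact ⟨lb, by simp, hi, hp, hr, fun g' γ' h' => ⟨hi, pc, hk, hc g' γ' h'⟩⟩

/-- The CAS compares the cell with `q` at this very moment, so it does not matter whether `b`
withdrew and republished its descriptor since `q` was read. -/
theorem ConfInv.collision {b : T} (h : ConfInv env C γ) (hl : C.thr t = some (l, c))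
    (hi : Invocation env t l) (hpc : PC.firstCAS.Inv empty t l C.gl γ)
    (hq : l.him.bind (Shared.location C.gl) = l.q) (hb : l.him = some b) :
    StepOutcome env C γ t (Label.arw (.prim STest.himEqQ) SAct.setHim)
      (C.set t (Shared.setLocation C.gl b (l.pushPop (some l.p) none))
        (l, some (PC.secondCAS.code l.p.op))) := by
  obtain ⟨hu, d, hd, hhim, hop⟩ := hpc
  have hid : d.id = b := Option.some.inj (hhim.symm.trans hb)
  have hloc : Shared.location C.gl b = some d := by simpa [hb, hd] using hq
  -- The first CAS has emptied the cell of `t`, so no thread collides with itself.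
  have hbt : b ≠ t := by
    rintro rfl
    simp [hu.2] at hloc
  obtain ⟨lb, hbn, hib, rfl, hrb, hcoll⟩ := (h.thr b).awaiting hloc hid
  set rt : Option Val := l.pushPop none lb.p.input with hrt
  set rb : Option Val := lb.pushPop none l.p.input with hrb'
  set g' : Shared T Val := (Shared.setLocation C.gl b (l.pushPop (some l.p) none)) with hg'
  -- The argument common to an initiating push and an initiating pop, which differ only in the order
  -- of the pair. The disjunction on inputs says that a passive pop finds the initiator's input in
  -- its cell, while a passive push returns NULL whatever is there.
  have key : ∀ new : List T, new = [t, b] ∨ new = [b, t] →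
      Linearizes env C ⟨γ.ts ++ new, Function.update (Function.update γ.res t (some rt)) b (some rb),
        γ.owner⟩ t (Label.arw (.prim STest.himEqQ) SAct.setHim) new →
      ((l.pushPop (some l.p) none).bind Desc.input = l.p.input ∨
        lb.p.op = .push) →
      (∃ os, List.Forall₂ (OpOf env ⟨γ.ts ++ new,
          Function.update (Function.update γ.res t (some rt)) b (some rb), γ.owner⟩) new os ∧
        ∀ s os', StackRun empty s os' → StackRun empty s (os ++ os')) →
      StepOutcome env C γ t (Label.arw (.prim STest.himEqQ) SAct.setHim)
        (C.set t g' (l, some (PC.secondCAS.code l.p.op))) := by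
    rintro new hnew hlin hin ⟨os, hos, hrun⟩
    have hmem : ∀ u, u ∈ new ↔ u = t ∨ u = b := by
      rcases hnew with rfl | rfl <;> simp [or_comm]
    have hnd : new.Nodup := by
      rcases hnew with rfl | rfl <;> simp [hbt, hbt.symm]
    have hres : ∀ u, u ∉ new →
        Function.update (Function.update γ.res t (some rt)) b (some rb) u = γ.res u := by
      intro u hu
      rw [hmem, not_or] at hu
      simp [hu.1, hu.2]
    refine ⟨_, new, h.extend ?_ rfl hnd ?_ hres ?_, ⟨rfl, hres, ?_, hlin, ?_⟩⟩
    · refine Config.forall_set (P := fun u x => ThreadInv env u _ _ x)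
        ⟨hi, .secondCAS, rfl, ?_, ?_⟩ fun u hut => ?_
      · simp [hbt.symm, hu.2, hg', Shared.setLocation, Config.set]
      · simp [hbt.symm, hd, hrt]
      · by_cases hub : u = b
        · subst hub
          refine hcoll _ _ ⟨?_, ?_⟩
          · rcases hin with hin | hin
            · simp [Config.set, hg', Shared.setLocation, hin, hrb']
            · simp [hrb', Locals.pushPop, hin]
          · intro d hd'
            have hd'' : l.pushPop (some l.p) none = some d := by
              simpa [Config.set, hg', Shared.setLocation] using hd'
            have : d = l.p := by
              unfold Locals.pushPop at hd''
              split at hd'' <;> simp_all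
            rw [this, hi.id]
            exact hut.symm
        · refine (h.thr u).mono ⟨by simp [hut, hub], ?_, fun _ _ h => h, fun _ _ h => h⟩
          exact Function.update_of_ne hub ..
    · intro u hu'
      rcases (hmem u).1 hu' with rfl | rfl
      · exact ⟨hu.1, by simp [hbt.symm]⟩
      · exact ⟨hrb, by simp⟩
    · exact fun s hs => ⟨s, os, hs.mono fun _ _ h => h, hos, hrun s⟩
    · intro u hu'
      rcases (hmem u).1 hu' with rfl | rfl
      · exact fun hn => by cases hl.symm.trans hn
      · exact hbn
    · intro r hr
      cases hr
  cases ht : l.p.op with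
  | push =>
    have hbo : lb.p.op = .pop := by
      cases hbo : lb.p.op
      · exact absurd (ht.trans hbo.symm) hop
      · rfl
    obtain ⟨x, hx, hin⟩ := hi.push ht
    have hy := hib.pop hbo
    rw [ht] at key
    refine key [t, b] (Or.inl rfl) (.collision rfl hl hb (Or.inl ⟨rfl, rfl⟩) hx hy)
      (Or.inl (by simp [Locals.pushPop, ht]))
      ⟨[⟨.push, x, none⟩, ⟨.pop, PUnit.unit, some x⟩], .cons ⟨hx, ?_⟩ (.cons ⟨hy, ?_⟩ .nil),
        fun s os' h' => ⟨rfl, rfl, h'⟩⟩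
    · simp [hbt.symm, hrt, Locals.pushPop, ht]
    · simp [hrb', Locals.pushPop, hbo, hin]
  | pop =>
    have hbo : lb.p.op = .push := by
      cases hbo : lb.p.op
      · rfl
      · exact absurd (ht.trans hbo.symm) hop
    obtain ⟨x, hx, hin⟩ := hib.push hbo
    have hy := hi.pop ht
    rw [ht] at key
    refine key [b, t] (Or.inr rfl) (.collision rfl hl hb (Or.inr ⟨rfl, rfl⟩) hx hy)
      (Or.inr hbo)
      ⟨[⟨.push, x, none⟩, ⟨.pop, PUnit.unit, some x⟩], .cons ⟨hx, ?_⟩ (.cons ⟨hy, ?_⟩ .nil),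
        fun s os' h' => ⟨rfl, rfl, h'⟩⟩
    · simp [hrb', Locals.pushPop, hbo]
    · simp [hbt.symm, hrt, Locals.pushPop, ht, hin]

/-- Every transition preserves the invariant. -/
theorem ConfInv.trans {C' : Config (elimStack T empty)} (h : ConfInv env C γ)
    (htr : Trans (elimStack T empty) env C (t, ℓ) C') : StepOutcome env C γ t ℓ C' := by
  cases htr with
  | inv he ht => exact h.inv he ht
  | @step _ l k _ l' g' k' ht hb =>
    have hthr := h.thr t
    rw [ht] at hthr
    obtain ⟨hi, pc, rfl, hpc⟩ := hthr
    obtain ⟨i, pc', hmem, rfl, he⟩ := hb.exec_next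
    have hloc := he.locals
    have htop : ∀ a, Shared.top C.gl = some a → ∃ d, Owns C.gl γ none a d := by
      intro a ha
      obtain ⟨s, _, hs, -⟩ := h.stack
      rw [ha] at hs
      exact hs.owns
    rcases hpc.step_cases hi.mytid hi.id htop hmem he with hs | ⟨rfl, rfl, rfl⟩ | ⟨rfl, rfl, rfl⟩ |
      ⟨hu, hop, hnull, rfl, rfl⟩ | ⟨rfl, rfl, rfl⟩
    · exact h.silent (hi.mono hloc) (by rw [hloc.2]) hs
    · obtain ⟨rfl, htest, rfl, rfl⟩ := he
      exact h.pushCAS ht hi hpc htest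
    · obtain ⟨rfl, htest, rfl, rfl⟩ := he
      exact h.popCAS ht hi hpc htest
    · obtain ⟨rfl, rfl, rfl⟩ := he
      exact h.emptyRead ht hi hu hop hnull
    · obtain ⟨rfl, htest, rfl, b, hb', rfl⟩ := he
      exact h.collision ht hi hpc htest hb'

end Preservation

/-! ### Linearization points of an execution -/

section Transitions

variable {T : Type u} {O : ConcObject.{u, v, w} T}

theorem Step.label_of_none {l l' : O.Lo} {g g' : O.Gl} {k : O.Code} {ℓ : Option (Label O)}
    {r : Option O.Code} (h : Step O l g k ℓ l' g' r) (hr : r = none) :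
    ∃ x, ℓ = some (.ret x) := by
  induction h with
  | ret => exact ⟨_, rfl⟩
  | seqRet _ ih => exact ih rfl
  | _ => cases hr

theorem BigStep.label_of_none {l l' : O.Lo} {g g' : O.Gl} {k : O.Code} {ℓ : Label O}
    {r : Option O.Code} (h : BigStep O l g k ℓ l' g' r) (hr : r = none) : ∃ x, ℓ = .ret x := by
  induction h with
  | last h =>
    obtain ⟨x, hx⟩ := h.label_of_none hr
    exact ⟨x, Option.some.inj hx⟩
  | silent _ _ ih => exact ih hr

variable [DecidableEq T] {env : Env O}

theorem Trans.thr_of_ne {C C' : Config O} {t u : T} {ℓ : Label O} (h : Trans O env C (t, ℓ) C')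
    (hu : u ≠ t) : C'.thr u = C.thr u := by
  cases h <;> exact Function.update_of_ne hu ..

theorem Trans.thr_self {C C' : Config O} {t : T} {ℓ : Label O} (h : Trans O env C (t, ℓ) C') :
    ∃ l k, C'.thr t = some (l, k) ∧ (k = none → ∃ r, ℓ = .ret r) ∧
      (C.thr t = none → ∃ m x, env t = some ⟨m, x⟩ ∧ ℓ = .inv m x) := by
  cases h with
  | inv he ht =>
    exact ⟨_, _, Function.update_self .., (fun h => by cases h), fun _ => ⟨_, _, he, rfl⟩⟩
  | step ht hb =>
    exact ⟨_, _, Function.update_self .., hb.label_of_none, fun h => by cases ht.symm.trans h⟩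

theorem Trans.invoked {C C' : Config O} {t u : T} {ℓ : Label O} (h : Trans O env C (t, ℓ) C')
    (hu : C.thr u ≠ none) : C'.thr u ≠ none := by
  by_cases hut : u = t
  · subst hut
    obtain ⟨l, k, hk, -⟩ := h.thr_self
    simp [hk]
  · rwa [h.thr_of_ne hut]

end Transitions

section History

variable {T : Type u} {Val : Type v} [DecidableEq T] {empty : Val}
  {env : Env (elimStack T empty)} {ρ : Execution (elimStack T empty) env}

/-- The `k`-th step is the read of NULL from `top` by a pop `t` bound to return `empty`. -/
def EmptyReadBound (ρ : Execution (elimStack T empty) env) (γ : Ghost T Val) (k : ℕ) (t : T) :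
    Prop :=
  EnvPop env t ∧ γ.res t = some (some empty) ∧
  ρ.trace[k]? = some (t, Label.act SAct.readTop) ∧ Shared.top (ρ.conf k).gl = none

/-- The relation of the linearization points to the first `i` steps of the execution. -/
structure History (ρ : Execution (elimStack T empty) env) (i : ℕ) (γ : Ghost T Val) (lp : T → ℕ) :
    Prop where
  lt : ∀ t ∈ γ.ts, lp t < i
  sorted : γ.ts.Pairwise fun s t => lp s ≤ lp t
  cases : ∀ t ∈ γ.ts, TopCASAt ρ (lp t) t ∨ EmptyReadBound ρ γ (lp t) t ∨
    ∃ a b, CollisionAt ρ (lp t) a b ∧ (t = a ∨ t = b)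
  topCAS : ∀ k < i, ∀ t, TopCASAt ρ k t → t ∈ γ.ts ∧ lp t = k
  collision : ∀ k < i, ∀ a b, CollisionAt ρ k a b → lp a = k ∧ lp b = k ∧
    ∃ s t x, (s = a ∧ t = b ∨ s = b ∧ t = a) ∧ EnvPush env s x ∧ EnvPop env t ∧
      ∃ ts₁ ts₂, γ.ts = ts₁ ++ s :: t :: ts₂
  inv : ∀ t, (ρ.conf i).thr t ≠ none → ∃ j < i, ∃ m x, env t = some ⟨m, x⟩ ∧
    ρ.trace[j]? = some (t, .inv m x) ∧ (t ∈ γ.ts → j < lp t)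
  ret : ∀ t l, (ρ.conf i).thr t = some (l, none) → ∃ j < i, ∃ r : Option Val,
    ρ.trace[j]? = some (t, Label.ret (O := elimStack T empty) r) ∧ lp t < j ∧ γ.res t = some r
  invoked : ∀ j < i, ∀ t m x, ρ.trace[j]? = some (t, .inv m x) → (ρ.conf i).thr t ≠ none

theorem History.zero (γ : Ghost T Val) (hγ : γ.ts = []) : History ρ 0 γ fun _ => 0 where
  lt := by simp [hγ]
  sorted := by simp [hγ]
  cases := by simp [hγ]
  topCAS := by simp
  collision := by simp
  inv t h := absurd (by rw [ρ.init]; rfl) h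
  ret t l h := by rw [ρ.init] at h; cases h
  invoked := by simp

/-- Threads linearized by step `i` get the point `i`. So do those not yet linearized, whose value is
unconstrained and is overwritten later. As `ts` grows only at its end, `lp` stays monotone along it
and collided pairs stay adjacent. -/
theorem History.succ {i : ℕ} {γ γ' : Ghost T Val} {lp : T → ℕ} {t : T}
    {ℓ : Label (elimStack T empty)} {new : List T} (h : History ρ i γ lp)
    (hC : ConfInv env (ρ.conf i) γ) (hC' : ConfInv env (ρ.conf (i + 1)) γ')
    (hℓ : ρ.trace[i]? = some (t, ℓ))
    (htr : Trans (elimStack T empty) env (ρ.conf i) (t, ℓ) (ρ.conf (i + 1)))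
    (hg : GhostStep env (ρ.conf i) γ γ' t ℓ new) :
    History ρ (i + 1) γ' fun u => if u ∈ γ.ts then lp u else i := by
  have hdisj : ∀ u ∈ γ.ts, u ∉ new := by
    have := hC'.nodup
    rw [hg.ts, List.nodup_append] at this
    exact fun u hu hn => this.2.2 u hu u hn rfl
  have hnew : ∀ u ∈ new, u ∉ γ.ts := fun u hn hu => hdisj u hu hn
  have hmem : ∀ u, u ∈ γ'.ts ↔ u ∈ γ.ts ∨ u ∈ new := fun u => by rw [hg.ts, List.mem_append]
  have hres : ∀ u ∈ γ.ts, γ'.res u = γ.res u := fun u hu => hg.res u (hdisj u hu)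
  refine ⟨?_, ?_, ?_, ?_, ?_, ?_, ?_, ?_⟩
  · intro u _
    split_ifs with hu
    · exact (h.lt u hu).trans (Nat.lt_succ_self i)
    · exact Nat.lt_succ_self i
  · rw [hg.ts, List.pairwise_append]
    refine ⟨h.sorted.imp_of_mem fun {a b} ha hb hab => ?_, ?_, fun a ha b hb => ?_⟩
    · simpa [ha, hb] using hab
    · refine List.pairwise_of_forall_mem_list fun a ha b hb => ?_
      simp [hnew a ha, hnew b hb]
    · simpa [ha, hnew b hb] using (h.lt a ha).le
  · intro u hu
    by_cases hu' : u ∈ γ.ts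
    · rw [if_pos hu']
      refine (h.cases u hu').imp id (Or.imp (fun he => ?_) id)
      exact ⟨he.1, (hres u hu').trans he.2.1, he.2.2⟩
    · rw [if_neg hu']
      replace hu : u ∈ new := ((hmem u).1 hu).resolve_left hu'
      cases hg.kind with
      | silent => cases hu
      | topCAS hk =>
        obtain rfl := List.mem_singleton.1 hu
        rcases hk with rfl | rfl
        · exact Or.inl (Or.inl hℓ)
        · exact Or.inl (Or.inr hℓ)
      | emptyRead hk htop henv hr =>
        obtain rfl := List.mem_singleton.1 hu
        subst hk
        exact Or.inr (Or.inl ⟨henv, hr, hℓ, htop⟩)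
      | @collision hk l c hl b s₁ s₂ x hhim hs h₁ h₂ =>
        subst hk
        refine Or.inr (Or.inr ⟨t, b, ⟨hℓ, l, c, hl, hhim⟩, ?_⟩)
        simp only [List.mem_cons, List.not_mem_nil, or_false] at hu
        rcases hs with ⟨rfl, rfl⟩ | ⟨rfl, rfl⟩
        · exact hu
        · exact hu.symm
  · intro k hk u htop
    rcases Nat.lt_succ_iff_lt_or_eq.1 hk with hk | rfl
    · obtain ⟨hu, hlp⟩ := h.topCAS k hk u htop
      exact ⟨(hmem u).2 (Or.inl hu), by rw [if_pos hu, hlp]⟩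
    · have hlab : u = t ∧ (ℓ = Label.arw (.prim STest.topEqOld) SAct.topToN ∨
          ℓ = Label.arw (.prim STest.topEqOld) SAct.topToNew) := by
        rcases htop with htop | htop <;> cases hℓ.symm.trans htop
        · exact ⟨rfl, Or.inl rfl⟩
        · exact ⟨rfl, Or.inr rfl⟩
      obtain ⟨rfl, hlab⟩ := hlab
      have hu : u ∈ new := by
        cases hg.kind with
        | silent hk => exact absurd (hlab.imp id Or.inl) hk
        | topCAS => simp
        | emptyRead => simp
        | collision _ _ _ hs => rcases hs with ⟨rfl, rfl⟩ | ⟨rfl, rfl⟩ <;> simp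
      exact ⟨(hmem u).2 (Or.inr hu), by rw [if_neg (hnew u hu)]⟩
  · intro k hk a b hab
    rcases Nat.lt_succ_iff_lt_or_eq.1 hk with hk | rfl
    · obtain ⟨ha, hb, s, u, x, hsu, hs, hu, ts₁, ts₂, hts⟩ := h.collision k hk a b hab
      have hmems : s ∈ γ.ts ∧ u ∈ γ.ts := by simp [hts]
      have hmemab : a ∈ γ.ts ∧ b ∈ γ.ts := by
        rcases hsu with ⟨rfl, rfl⟩ | ⟨rfl, rfl⟩
        · exact hmems
        · exact hmems.symm
      refine ⟨by rw [if_pos hmemab.1, ha], by rw [if_pos hmemab.2, hb], s, u, x, hsu, hs, hu,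
        ts₁, ts₂ ++ new, ?_⟩
      rw [hg.ts, hts]
      simp
    · obtain ⟨hlab, l, c, hl, hhim⟩ := hab
      cases hℓ.symm.trans hlab
      cases hg.kind with
      | silent hk => exact absurd (Or.inr (Or.inr rfl)) hk
      | topCAS hk => rcases hk with hk | hk <;> cases hk
      | emptyRead hk => cases hk
      | @collision _ l' c' hl' b' s₁ s₂ x hhim' hs h₁ h₂ =>
        cases hl.symm.trans hl'
        obtain rfl : b = b' := Option.some.inj (hhim.symm.trans hhim')
        have hn : t ∉ γ.ts ∧ b ∉ γ.ts := by
          rcases hs with ⟨rfl, rfl⟩ | ⟨rfl, rfl⟩ <;>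
            exact ⟨hnew _ (by simp), hnew _ (by simp)⟩
        exact ⟨if_neg hn.1, if_neg hn.2, s₁, s₂, x, hs, h₁, h₂, γ.ts, [], hg.ts⟩
  · intro u hu
    by_cases hi : (ρ.conf i).thr u = none
    · obtain rfl : u = t := by
        by_contra hut
        exact hu ((htr.thr_of_ne hut).trans hi)
      obtain ⟨_, _, -, -, hinv⟩ := htr.thr_self
      obtain ⟨m, x, henv, rfl⟩ := hinv hi
      refine ⟨i, Nat.lt_succ_self i, m, x, henv, hℓ, fun hts => ?_⟩
      -- A thread invoked by this very step is not linearized: it was `Unlin` before, and the step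
      -- linearizes only threads invoked earlier.
      exfalso
      rcases (hmem u).1 hts with hts | hts
      · have hun := hC.thr u
        rw [hi] at hun
        exact (hC.mem_iff u).1 hts hun.1
      · exact hg.invoked u hts hi
    · obtain ⟨j, hj, m, x, henv, hτ, hlp⟩ := h.inv u hi
      refine ⟨j, hj.trans (Nat.lt_succ_self i), m, x, henv, hτ, fun _ => ?_⟩
      split_ifs with hu'
      · exact hlp hu'
      · exact hj
  · intro u l hu
    by_cases hut : u = t
    · subst hut
      obtain ⟨l', k, hk, hret, -⟩ := htr.thr_self
      obtain ⟨r, rfl⟩ := hret (by rw [hu] at hk; cases hk; rfl)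
      -- The returned value was already promised, so the thread was linearized at an earlier step.
      have hr := hg.ret r rfl
      have hmem' : u ∈ γ.ts := (hC.mem_iff u).2 (by rw [hr]; simp)
      refine ⟨i, Nat.lt_succ_self i, r, hℓ, ?_, (hres u hmem').trans hr⟩
      rw [if_pos hmem']
      exact h.lt u hmem'
    · rw [htr.thr_of_ne hut] at hu
      obtain ⟨j, hj, r, hτ, hlp, hr⟩ := h.ret u l hu
      have hmem' : u ∈ γ.ts := (hC.mem_iff u).2 (by rw [hr]; simp)
      refine ⟨j, hj.trans (Nat.lt_succ_self i), r, hτ, ?_, (hres u hmem').trans hr⟩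
      rwa [if_pos hmem']
  · intro j hj u m x hτ
    rcases Nat.lt_succ_iff_lt_or_eq.1 hj with hj | rfl
    · exact htr.invoked (h.invoked j hj u m x hτ)
    · cases hℓ.symm.trans hτ
      obtain ⟨_, _, hk, -⟩ := htr.thr_self
      simp [hk]

/-! ### Linearization of completed executions -/

theorem exists_history (ρ : Execution (elimStack T empty) env) (i : ℕ) (hi : i ≤ ρ.trace.length) :
    ∃ γ lp, ConfInv env (ρ.conf i) γ ∧ History ρ i γ lp := by
  induction i with
  | zero =>
    refine ⟨⟨[], fun _ => none, fun _ => none⟩, _, ?_, History.zero _ rfl⟩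
    rw [ρ.init]
    exact ConfInv.init
  | succ i ih =>
    obtain ⟨γ, lp, hC, hH⟩ := ih (by omega)
    have htr := ρ.step i hi
    obtain ⟨γ', new, hC', hg⟩ := hC.trans htr
    exact ⟨γ', _, hC', hH.succ hC hC' (List.getElem?_eq_getElem hi) htr hg⟩

/-- Every completed execution of the elimination stack has a linearization by its linearization
points. -/
theorem exists_linearization (ρ : Execution (elimStack T empty) env) (hρ : ρ.Completed) :
    ∃ (lp : T → ℕ) (ts : List T),
      IsLinearization (stackSpec empty) ρ.trace lp ts ∧ HasElimLinPoints ρ lp ts := by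
  obtain ⟨γ, lp, hC, hH⟩ := exists_history ρ _ le_rfl
  have hfin : ∀ t, (ρ.conf ρ.trace.length).thr t ≠ none →
      ∃ l, (ρ.conf ρ.trace.length).thr t = some (l, none) := by
    intro t ht
    obtain ⟨⟨l, k⟩, hk⟩ := Option.ne_none_iff_exists'.1 ht
    exact ⟨l, by rw [hk, hρ t l k hk]⟩
  have hmem : ∀ t, t ∈ γ.ts ↔ (ρ.conf ρ.trace.length).thr t ≠ none := by
    intro t
    refine ⟨fun ht hn => ?_, fun ht => ?_⟩
    · have hun := hC.thr t
      rw [hn] at hun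
      exact (hC.mem_iff t).1 ht hun.1
    · obtain ⟨l, hl⟩ := hfin t ht
      obtain ⟨_, _, r, -, -, hr⟩ := hH.ret t l hl
      exact (hC.mem_iff t).2 (by rw [hr]; simp)
  have hinv : ∀ t ∈ γ.ts, ∃ j, ∃ m x, env t = some ⟨m, x⟩ ∧
      ρ.trace[j]? = some (t, .inv m x) ∧ j < lp t := by
    intro t ht
    obtain ⟨j, _, m, x, henv, hτ, hlp⟩ := hH.inv t ((hmem t).1 ht)
    exact ⟨j, m, x, henv, hτ, hlp ht⟩
  have hret : ∀ t ∈ γ.ts, ∃ j, ∃ r : Option Val,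
      ρ.trace[j]? = some (t, Label.ret (O := elimStack T empty) r) ∧ lp t < j ∧
        γ.res t = some r := by
    intro t ht
    obtain ⟨l, hl⟩ := hfin t ((hmem t).1 ht)
    obtain ⟨j, _, r, hr⟩ := hH.ret t l hl
    exact ⟨j, r, hr⟩
  have hop : ∀ t ∈ γ.ts, ∀ o : StackOp Val, OpOf env γ t o → OperationOf ρ.trace t o := by
    rintro t ht ⟨m, x, r⟩ ⟨henv, hr⟩
    obtain ⟨j, m', x', henv', hτ, -⟩ := hinv t ht
    obtain ⟨j', r', hτ', -, hr'⟩ := hret t ht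
    cases henv.symm.trans henv'
    cases hr.symm.trans hr'
    exact ⟨List.mem_of_getElem? hτ, List.mem_of_getElem? hτ'⟩
  have hinvokes : ∀ t ∈ γ.ts, ∀ m x, env t = some ⟨m, x⟩ → Invokes ρ t m := by
    intro t ht m x henv
    obtain ⟨j, m', x', henv', hτ, -⟩ := hinv t ht
    cases henv.symm.trans henv'
    exact ⟨x, List.mem_of_getElem? hτ⟩
  refine ⟨lp, γ.ts, ⟨hC.nodup, ?_, hH.sorted, ?_, ?_⟩, ⟨?_, ?_, ?_⟩⟩
  · intro t
    refine ⟨fun ht => ?_, ?_⟩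
    · obtain ⟨j, m, x, -, hτ, -⟩ := hinv t ht
      exact ⟨m, x, List.mem_of_getElem? hτ⟩
    · rintro ⟨m, x, hτ⟩
      obtain ⟨j, hj, hτ⟩ := List.getElem_of_mem hτ
      exact (hmem t).2 (hH.invoked j hj t m x (by rw [List.getElem?_eq_getElem hj, hτ]))
  · intro t ht
    obtain ⟨i, m, x, -, hi, hlt⟩ := hinv t ht
    obtain ⟨j, r, hj, hlt', -⟩ := hret t ht
    exact ⟨i, j, m, x, r, hlt, hlt', hi, hj⟩
  · obtain ⟨s, os, -, hos, hrun⟩ := hC.stack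
    -- The empty continuation turns the invariant into membership of `os` in the specification.
    have hnil : StackRun empty s [] := by cases s <;> trivial
    refine ⟨os, ?_, forall₂_imp_of_mem hos hop⟩
    have := hrun [] hnil
    rwa [List.append_nil] at this
  · intro t ht
    refine (hH.cases t ht).imp id (Or.imp (fun h => ?_) id)
    -- In a completed execution every promise has been kept, so being bound to return `empty` has
    -- become returning it.
    exact ⟨hop t ht ⟨.pop, PUnit.unit, some empty⟩ ⟨h.1, h.2.1⟩, h.2.2⟩
  · intro k t hk
    have hlt : k < ρ.trace.length := by
      rcases hk with hk | hk <;> exact (List.getElem?_eq_some_iff.1 hk).1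
    exact (hH.topCAS k hlt t hk).2
  · intro k a b hk
    have hlt : k < ρ.trace.length := (List.getElem?_eq_some_iff.1 hk.1).1
    obtain ⟨ha, hb, s, t, x, hst, hs, ht, ts₁, ts₂, hts⟩ := hH.collision k hlt a b hk
    exact ⟨ha, hb, s, t, hst, hinvokes s (by simp [hts]) _ _ hs,
      hinvokes t (by simp [hts]) _ _ ht, ts₁, ts₂, hts⟩

end History

end KatObj

theorem mainTheorem8 {T : Type*} [DecidableEq T] {Val : Type*} (empty : Val) :
    KatObj.Linearizable (KatObj.elimStack T empty) (KatObj.stackSpec empty) ∧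
    ∀ (env : KatObj.Env (KatObj.elimStack T empty))
      (ρ : KatObj.Execution (KatObj.elimStack T empty) env), ρ.Completed →
      ∃ (lp : T → ℕ) (ts : List T),
        KatObj.IsLinearization (KatObj.stackSpec empty) ρ.trace lp ts ∧
        KatObj.HasElimLinPoints ρ lp ts := by
  refine ⟨?_, fun env ρ hρ => KatObj.exists_linearization ρ hρ⟩
  rintro τ ⟨env, ρ, hρ, rfl⟩
  obtain ⟨lp, ts, h, -⟩ := KatObj.exists_linearization ρ hρ
  exact ⟨lp, ts, h⟩
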